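/- Let $K\ge 2$ be even, let $v_{i_1i_2j_1j_2}\in\mathbb R$ ($1\le i_1,i_2,j_1,j_2\le K$) be arbitrary, and put $$S=\begin{pmatrix}1&0\\0&-1\end{pmatrix},\quad A=\begin{pmatrix}0&1\\0&0\end{pmatrix},\quad I=\begin{pmatrix}1&0\\0&1\end{pmatrix},\quad A^*=A^{T},\qquad a_i=S^{\otimes(i-1)}\otimes A\otimes I^{\otimes(K-i)},\quad a_i^*=a_i^T,$$ $$D=\sum_{i_1,i_2,j_1,j_2=1}^K v_{i_1i_2j_1j_2}\,a_{i_1}^*a_{i_2}^*a_{j_1}a_{j_2}\quad\text{on }(\mathbb R^2)^{\otimes K}.$$ A matrix product operator (MPO) with ranks $r_0=1,r_1,\dots,r_{K-1},r_K=1\in\mathbb N_0$ consists of cores $M_k$, i.e. $r_{k-1}\times r_k$ block matrices of $2\times2$ matrices $M_k^{[j,j']}$, and represents the operator $M_1\bowtie\cdots\bowtie M_K=\sum_{j_0,\dots,j_K}M_1^{[j_0,j_1]}\otimes\cdots\otimes M_K^{[j_{K-1},j_K]}$. For a core $M$ and a matrix $G$, $MG$ is the core with blocks $(MG)^{[j,j'']}=\sum_{j'}M^{[j,j']}G_{j'j''}$.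 Let $w_{i_1i_2j_1j_2}=-(v_{i_1i_2j_1j_2}+v_{i_2i_1j_2j_1}-v_{i_2i_1j_1j_2}-v_{i_1i_2j_2j_1})$ if $i_1<i_2$ and $j_1<j_2$, and $w_{i_1i_2j_1j_2}=0$ otherwise. Rank indices carry labels $\mathsf I,\ \mathsf a^*_i,\ \mathsf a_j,\ \mathsf b_{ij},\ \mathsf c^*_{i_1i_2},\ \mathsf c_{j_1j_2}$ ($i_1<i_2$, $j_1<j_2$), $\mathsf e_j,\ \mathsf e^*_i,\ \mathsf D$. The left index set $L_k$ ($0\le k\le K/2$) consists of $\mathsf I,\mathsf a^*,\mathsf a,\mathsf b,\mathsf c^*,\mathsf c$ with all orbital indices $\le k$ and, only if $k\ge2$, of $\mathsf e_j,\mathsf e^*_i$ with index $>k$ and $\mathsf D$. The right index set $R_k$ ($K/2\le k\le K$) consists of $\mathsf I,\mathsf a^*,\mathsf a,\mathsf b,\mathsf c^*,\mathsf c$ with all orbital indices $>k$ and, only if $k\le K-2$, of $\mathsf e_j,\mathsf e^*_i$ with index $\le k$ and $\mathsf D$. For $k\le K/2$ the core $V_k$ has rows $L_{k-1}$, columns $L_k$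 and the following blocks (all others are $0$): - $[\mathsf I,\mathsf I]=I$, $[\mathsf I,\mathsf a^*_k]=A^*$, $[\mathsf I,\mathsf a_k]=A$, $[\mathsf I,\mathsf b_{kk}]=A^*A$; - $[\mathsf a^*_i,\mathsf a^*_i]=S$, $[\mathsf a^*_i,\mathsf b_{ik}]=A$, $[\mathsf a^*_i,\mathsf c^*_{ik}]=A^*$, $[\mathsf a_j,\mathsf a_j]=S$, $[\mathsf a_j,\mathsf b_{kj}]=A^*$, $[\mathsf a_j,\mathsf c_{jk}]=A$; - $[\mathsf b_{ij},\mathsf b_{ij}]=[\mathsf c^*_{i_1i_2},\mathsf c^*_{i_1i_2}]=[\mathsf c_{j_1j_2},\mathsf c_{j_1j_2}]=I$; - $[\mathsf a^*_{i_1},\mathsf e_{j_2}]=w_{i_1kkj_2}A^*A$, $[\mathsf b_{i_1j_1},\mathsf e_{j_2}]=w_{i_1kj_1j_2}A^*$, $[\mathsf c^*_{i_1i_2},\mathsf e_{j_2}]=w_{i_1i_2kj_2}A$; - $[\mathsf a_{j_1},\mathsf e^*_{i_2}]=w_{ki_2j_1k}A^*A$, $[\mathsf b_{i_1j_1},\mathsf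 e^*_{i_2}]=w_{i_1i_2j_1k}A$, $[\mathsf c_{j_1j_2},\mathsf e^*_{i_2}]=w_{ki_2j_1j_2}A^*$; - $[\mathsf b_{i_1j_1},\mathsf D]=w_{i_1kj_1k}A^*A$, $[\mathsf e_k,\mathsf D]=A$, $[\mathsf e^*_k,\mathsf D]=A^*$, $[\mathsf D,\mathsf D]=I$, $[\mathsf e_j,\mathsf e_j]=[\mathsf e^*_i,\mathsf e^*_i]=S$. For $k>K/2$ the core $V_k$ has rows $R_{k-1}$, columns $R_k$ and the following blocks (all others are $0$): - $[\mathsf I,\mathsf I]=I$, $[\mathsf a^*_k,\mathsf I]=A^*$, $[\mathsf a_k,\mathsf I]=A$, $[\mathsf b_{kk},\mathsf I]=A^*A$; - $[\mathsf a^*_i,\mathsf a^*_i]=S$, $[\mathsf b_{ik},\mathsf a^*_i]=A$, $[\mathsf c^*_{ki},\mathsf a^*_i]=A^*$, $[\mathsf a_j,\mathsf a_j]=S$, $[\mathsf b_{kj},\mathsf a_j]=A^*$, $[\mathsf c_{kj},\mathsf a_j]=A$; - $[\mathsf b_{ij},\mathsf b_{ij}]=[\mathsf c^*_{i_1i_2},\mathsf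 c^*_{i_1i_2}]=[\mathsf c_{j_1j_2},\mathsf c_{j_1j_2}]=I$; - $[\mathsf e^*_{i_1},\mathsf a_{j_2}]=w_{i_1kkj_2}A^*A$, $[\mathsf e^*_{i_1},\mathsf b_{i_2j_2}]=w_{i_1i_2kj_2}A$, $[\mathsf e^*_{i_1},\mathsf c_{j_1j_2}]=w_{i_1kj_1j_2}A^*$; - $[\mathsf e_{j_1},\mathsf a^*_{i_2}]=w_{ki_2j_1k}A^*A$, $[\mathsf e_{j_1},\mathsf b_{i_2j_2}]=w_{ki_2j_1j_2}A^*$, $[\mathsf e_{j_1},\mathsf c^*_{i_1i_2}]=w_{i_1i_2j_1k}A$; - $[\mathsf D,\mathsf b_{i_2j_2}]=w_{ki_2kj_2}A^*A$, $[\mathsf D,\mathsf e_k]=A$, $[\mathsf D,\mathsf e^*_k]=A^*$, $[\mathsf D,\mathsf D]=I$, $[\mathsf e_j,\mathsf e_j]=[\mathsf e^*_i,\mathsf e^*_i]=S$. The matrix $M_V$ has rows $L_{K/2}$, columns $R_{K/2}$ and the entries (all others are $0$): $1$ at $(\mathsf I,\mathsf D)$, $(\mathsf a^*_i,\mathsf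 e^*_i)$, $(\mathsf a_j,\mathsf e_j)$, $(\mathsf e_j,\mathsf a_j)$, $(\mathsf e^*_i,\mathsf a^*_i)$, $(\mathsf D,\mathsf I)$, and $w_{i_1i_2j_1j_2}$ at $(\mathsf b_{i_1j_1},\mathsf b_{i_2j_2})$, $(\mathsf c^*_{i_1i_2},\mathsf c_{j_1j_2})$ and $(\mathsf c_{j_1j_2},\mathsf c^*_{i_1i_2})$. **Theorem.** 1. $D=V_1\bowtie\cdots\bowtie V_{K/2}M_V\bowtie V_{K/2+1}\bowtie\cdots\bowtie V_K$. 2. All ranks of this MPO representation of $D$ are at most $\frac12K^2+\frac32K+2$. 3. If $d\ge1$ is an integer such that $v_{i_1i_2j_1j_2}=0$ whenever $\max\{|i_1-i_2|,|i_1-j_1|,|i_1-j_2|,|i_2-j_1|,|i_2-j_2|,|j_1-j_2|\}>d$, then $D$ has an MPO representation all of whose ranks are at most $d^2+3d-1$ if $d$ is odd and at most $d^2+3d-2$ if $d$ is even. -/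

import Mathlib

/-! Occupation-number tensors with `K` orbitals have entries indexed by `α : Fin K → Fin 2`; orbitals
are numbered `0, …, K - 1`. Operators on them are identified with their matrices. -/

namespace FockMPO

/-- The elementary component `S = diag(1, -1)`. -/
def matS : Matrix (Fin 2) (Fin 2) ℝ := !![1, 0; 0, -1]

/-- The elementary component `A`, the annihilator of a single orbital; `A* = Aᵀ`. -/
def matA : Matrix (Fin 2) (Fin 2) ℝ := !![0, 1; 0, 0]

/-- The Kronecker product `M₀ ⊗ M₁ ⊗ ⋯ ⊗ M_{K-1}` of `2 × 2` matrices. -/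
def kron {K : ℕ} (M : Fin K → Matrix (Fin 2) (Fin 2) ℝ) :
    Matrix (Fin K → Fin 2) (Fin K → Fin 2) ℝ :=
  fun α β => ∏ k, M k (α k) (β k)

/-- The annihilation operator `a_i = S ⊗ ⋯ ⊗ S ⊗ A ⊗ I ⊗ ⋯ ⊗ I`, with `A` in position `i`. -/
def annihilation {K : ℕ} (i : Fin K) : Matrix (Fin K → Fin 2) (Fin K → Fin 2) ℝ :=
  kron fun k => if k < i then matS else if k = i then matA else 1

/-- The creation operator `a_i*`. -/
def creation {K : ℕ} (i : Fin K) : Matrix (Fin K → Fin 2) (Fin K → Fin 2) ℝ :=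
  (annihilation i).transpose

/-- The two-particle operator `D = ∑ v_{i₁ i₂ j₁ j₂} a_{i₁}* a_{i₂}* a_{j₁} a_{j₂}`. -/
def twoParticle {K : ℕ} (v : Fin K → Fin K → Fin K → Fin K → ℝ) :
    Matrix (Fin K → Fin 2) (Fin K → Fin 2) ℝ :=
  ∑ i₁, ∑ i₂, ∑ j₁, ∑ j₂,
    v i₁ i₂ j₁ j₂ • (creation i₁ * creation i₂ * annihilation j₁ * annihilation j₂)

/-- A matrix product operator in `K` sites: bond `k` is the (finite) range of the rank index `j_k`,
`k = 0, …, K`, with singleton bonds at both ends, and `core k` is the core of site `k`, with entries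
`core k j_k j_{k+1} α β`. -/
structure MPO (K : ℕ) where
  /-- the index set of the `k`-th rank index -/
  bond : Fin (K + 1) → Type
  /-- index sets are finite -/
  fin : ∀ k, Fintype (bond k)
  /-- trivial leading rank -/
  card_first : Fintype.card (bond 0) = 1
  /-- trivial trailing rank -/
  card_last : Fintype.card (bond (Fin.last K)) = 1
  /-- the cores, written as blocks of `2 × 2` matrices -/
  core : ∀ k : Fin K, bond k.castSucc → bond k.succ → Matrix (Fin 2) (Fin 2) ℝ

attribute [instance] MPO.fin

/-- The rank `r_k` of a matrix product operator. -/
def MPO.rank {K : ℕ} (M : MPO K) (k : Fin (K + 1)) : ℕ := Fintype.card (M.bond k)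

/-- The operator represented by the cores (their strong Kronecker product):
`∑_{j_0, …, j_K} ∏_k M_k(j_k, α_k, β_k, j_{k+1})`. -/
def MPO.toMatrix {K : ℕ} (M : MPO K) : Matrix (Fin K → Fin 2) (Fin K → Fin 2) ℝ :=
  fun α β => ∑ j : (∀ k, M.bond k), ∏ k : Fin K, M.core k (j k.castSucc) (j k.succ) (α k) (β k)

/-! ### The explicit matrix product operator -/

/-- The antisymmetrized coefficients `ṽ`, supported on `i₁ < i₂`, `j₁ < j₂`. -/
def vTilde {K : ℕ} (v : Fin K → Fin K → Fin K → Fin K → ℝ) (i₁ i₂ j₁ j₂ : Fin K) : ℝ :=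
  if i₁ < i₂ ∧ j₁ < j₂ then
    v i₁ i₂ j₁ j₂ + v i₂ i₁ j₂ j₁ - v i₂ i₁ j₁ j₂ - v i₁ i₂ j₂ j₁
  else 0

/-- Names of the rank indices, in the order of the block rows and columns of the cores:
`I`, `a*_i`, `a_j`, `b_{i j}`, `c*_{i₁ i₂}`, `c_{j₁ j₂}`, `e_j`, `e*_i`, `D`. -/
inductive Label (K : ℕ) : Type
  | one : Label K
  | cre (i : Fin K) : Label K
  | ann (j : Fin K) : Label K
  | num (i j : Fin K) : Label K
  | cre₂ (i₁ i₂ : Fin K) : Label K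
  | ann₂ (j₁ j₂ : Fin K) : Label K
  | e (j : Fin K) : Label K
  | eStar (i : Fin K) : Label K
  | full : Label K
  deriving DecidableEq, Fintype

/-- The rank indices between the sites `< s` and the sites `≥ s`, as used in the left half: `I`, `a*`,
`a`, `b`, `c*`, `c` refer to orbitals on the left of the cut, `e`, `e*` to an orbital on its right;
`e`, `e*`, `D` occur only if there are at least two sites on the left. -/
def IsLeft {K : ℕ} (s : ℕ) : Label K → Prop
  | .one => True
  | .cre i => i.val < s
  | .ann j => j.val < s
  | .num i j => i.val < s ∧ j.val < s
  | .cre₂ i₁ i₂ => i₁ < i₂ ∧ i₂.val < s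
  | .ann₂ j₁ j₂ => j₁ < j₂ ∧ j₂.val < s
  | .e j => 2 ≤ s ∧ s ≤ j.val
  | .eStar i => 2 ≤ s ∧ s ≤ i.val
  | .full => 2 ≤ s

/-- The mirror image of `IsLeft`, as used in the right half. -/
def IsRight {K : ℕ} (s : ℕ) : Label K → Prop
  | .one => True
  | .cre i => s ≤ i.val
  | .ann j => s ≤ j.val
  | .num i j => s ≤ i.val ∧ s ≤ j.val
  | .cre₂ i₁ i₂ => s ≤ i₁.val ∧ i₁ < i₂
  | .ann₂ j₁ j₂ => s ≤ j₁.val ∧ j₁ < j₂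
  | .e j => s + 2 ≤ K ∧ j.val < s
  | .eStar i => s + 2 ≤ K ∧ i.val < s
  | .full => s + 2 ≤ K

instance {K : ℕ} (s : ℕ) : DecidablePred (IsLeft (K := K) s) := fun l => by
  cases l <;> unfold IsLeft <;> infer_instance

instance {K : ℕ} (s : ℕ) : DecidablePred (IsRight (K := K) s) := fun l => by
  cases l <;> unfold IsRight <;> infer_instance

/-- The core `V_k` of a site `k` in the left half, with coefficient slices taken from `w`; the row
label belongs to the cut in front of site `k`, the column label to the cut behind it. -/
def leftCore {K : ℕ} (w : Fin K → Fin K → Fin K → Fin K → ℝ) (k : Fin K) :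
    Label K → Label K → Matrix (Fin 2) (Fin 2) ℝ
  | .one, .one => 1
  | .one, .cre i => if i = k then matA.transpose else 0
  | .one, .ann j => if j = k then matA else 0
  | .one, .num i j => if i = k ∧ j = k then matA.transpose * matA else 0
  | .cre i, .cre i' => if i' = i then matS else 0
  | .cre i, .num i' j' => if i' = i ∧ j' = k then matA else 0
  | .cre i, .cre₂ i₁ i₂ => if i₁ = i ∧ i₂ = k then matA.transpose else 0
  | .ann j, .ann j' => if j' = j then matS else 0
  | .ann j, .num i' j' => if i' = k ∧ j' = j then matA.transpose else 0
  | .ann j, .ann₂ j₁ j₂ => if j₁ = j ∧ j₂ = k then matA else 0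
  | .num i j, .num i' j' => if i' = i ∧ j' = j then 1 else 0
  | .cre₂ i₁ i₂, .cre₂ i₁' i₂' => if i₁' = i₁ ∧ i₂' = i₂ then 1 else 0
  | .ann₂ j₁ j₂, .ann₂ j₁' j₂' => if j₁' = j₁ ∧ j₂' = j₂ then 1 else 0
  | .cre i₁, .e j₂ => w i₁ k k j₂ • (matA.transpose * matA)
  | .ann j₁, .eStar i₂ => w k i₂ j₁ k • (matA.transpose * matA)
  | .num i₁ j₁, .e j₂ => w i₁ k j₁ j₂ • matA.transpose
  | .num i₁ j₁, .eStar i₂ => w i₁ i₂ j₁ k • matA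
  | .num i₁ j₁, .full => w i₁ k j₁ k • (matA.transpose * matA)
  | .cre₂ i₁ i₂, .e j₂ => w i₁ i₂ k j₂ • matA
  | .ann₂ j₁ j₂, .eStar i₂ => w k i₂ j₁ j₂ • matA.transpose
  | .e j, .e j' => if j' = j then matS else 0
  | .e j, .full => if j = k then matA else 0
  | .eStar i, .eStar i' => if i' = i then matS else 0
  | .eStar i, .full => if i = k then matA.transpose else 0
  | .full, .full => 1
  | _, _ => 0

/-- The core `V_k` of a site `k` in the right half, of the mirrored block structure. -/
def rightCore {K : ℕ} (w : Fin K → Fin K → Fin K → Fin K → ℝ) (k : Fin K) :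
    Label K → Label K → Matrix (Fin 2) (Fin 2) ℝ
  | .one, .one => 1
  | .cre i, .one => if i = k then matA.transpose else 0
  | .ann j, .one => if j = k then matA else 0
  | .num i j, .one => if i = k ∧ j = k then matA.transpose * matA else 0
  | .cre i', .cre i => if i' = i then matS else 0
  | .num i' j', .cre i => if i' = i ∧ j' = k then matA else 0
  | .cre₂ i₁ i₂, .cre i => if i₁ = k ∧ i₂ = i then matA.transpose else 0
  | .ann j', .ann j => if j' = j then matS else 0
  | .num i' j', .ann j => if i' = k ∧ j' = j then matA.transpose else 0
  | .ann₂ j₁ j₂, .ann j => if j₁ = k ∧ j₂ = j then matA else 0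
  | .num i' j', .num i j => if i' = i ∧ j' = j then 1 else 0
  | .cre₂ i₁' i₂', .cre₂ i₁ i₂ => if i₁' = i₁ ∧ i₂' = i₂ then 1 else 0
  | .ann₂ j₁' j₂', .ann₂ j₁ j₂ => if j₁' = j₁ ∧ j₂' = j₂ then 1 else 0
  | .eStar i₁, .ann j₂ => w i₁ k k j₂ • (matA.transpose * matA)
  | .e j₁, .cre i₂ => w k i₂ j₁ k • (matA.transpose * matA)
  | .e j₁, .num i₂ j₂ => w k i₂ j₁ j₂ • matA.transpose
  | .eStar i₁, .num i₂ j₂ => w i₁ i₂ k j₂ • matA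
  | .full, .num i₂ j₂ => w k i₂ k j₂ • (matA.transpose * matA)
  | .e j₁, .cre₂ i₁ i₂ => w i₁ i₂ j₁ k • matA
  | .eStar i₁, .ann₂ j₁ j₂ => w i₁ k j₁ j₂ • matA.transpose
  | .e j', .e j => if j' = j then matS else 0
  | .full, .e j => if j = k then matA else 0
  | .eStar i', .eStar i => if i' = i then matS else 0
  | .full, .eStar i => if i = k then matA.transpose else 0
  | .full, .full => 1
  | _, _ => 0

/-- The middle matrix `M_V`, coupling the rank indices of the left half to those of the right half:
ones on the outer antidiagonals, and the three coefficient blocks of `V_mid`. -/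
def midMatrix {K : ℕ} (w : Fin K → Fin K → Fin K → Fin K → ℝ) : Label K → Label K → ℝ
  | .one, .full => 1
  | .cre i, .eStar i' => if i = i' then 1 else 0
  | .ann j, .e j' => if j = j' then 1 else 0
  | .num i₁ j₁, .num i₂ j₂ => w i₁ i₂ j₁ j₂
  | .cre₂ i₁ i₂, .ann₂ j₁ j₂ => w i₁ i₂ j₁ j₂
  | .ann₂ j₁ j₂, .cre₂ i₁ i₂ => w i₁ i₂ j₁ j₂
  | .e j, .ann j' => if j = j' then 1 else 0
  | .eStar i, .cre i' => if i = i' then 1 else 0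
  | .full, .one => 1
  | _, _ => 0

/-- The rank indices at cut `s` of the explicit matrix product operator: the `s`-th cut is of left type
for `s < K / 2` and of right type for `s ≥ K / 2`. -/
def IsBond (K s : ℕ) (l : Label K) : Prop := if s < K / 2 then IsLeft s l else IsRight s l

instance (K s : ℕ) : DecidablePred (IsBond K s) := fun l => by
  unfold IsBond; infer_instance

/-- `V_1 ⋈ ⋯ ⋈ V_{K/2} M_V ⋈ V_{K/2+1} ⋈ ⋯ ⋈ V_K`. In the core `V_{K/2} M_V`, the matrix `M_V` is
multiplied from the right to the column rank index of `V_{K/2}`. All coefficient slices are those of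
`-ṽ`: the sign comes from the reordering of `a_{i₁}* a_{i₂}* a_{j₁} a_{j₂}`. -/
def explicitMPO {K : ℕ} (hK : 2 ≤ K) (v : Fin K → Fin K → Fin K → Fin K → ℝ) : MPO K where
  bond k := {l : Label K // IsBond K k.val l}
  fin _ := inferInstance
  card_first := by
    refine Fintype.card_eq_one_iff.2 ⟨⟨.one, ?_⟩, ?_⟩
    · simp [IsBond, IsLeft, IsRight]
    · rintro ⟨l, hl⟩
      have h2 : 0 < K / 2 := by omega
      cases l <;> simp only [IsBond, IsLeft, Fin.val_zero, h2, if_true] at hl <;>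
        first | rfl | omega
  card_last := by
    refine Fintype.card_eq_one_iff.2 ⟨⟨.one, ?_⟩, ?_⟩
    · simp [IsBond, IsLeft, IsRight]
    · rintro ⟨l, hl⟩
      have h2 : ¬ (K < K / 2) := by omega
      cases l <;> simp only [IsBond, IsRight, Fin.val_last, h2, if_false] at hl <;>
        first | rfl | omega
  core k l l' :=
    if k.val + 1 < K / 2 then leftCore (fun a b c d => -vTilde v a b c d) k l.1 l'.1
    else if k.val + 1 = K / 2 then
      ∑ m : {m : Label K // IsLeft (K / 2) m},
        midMatrix (fun a b c d => -vTilde v a b c d) m.1 l'.1 •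
          leftCore (fun a b c d => -vTilde v a b c d) k l.1 m.1
    else rightCore (fun a b c d => -vTilde v a b c d) k l.1 l'.1

/-- The largest distance between two of the four orbital indices. -/
def spread {K : ℕ} (i₁ i₂ j₁ j₂ : Fin K) : ℤ :=
  max |(i₁.val : ℤ) - i₂.val| (max |(i₁.val : ℤ) - j₁.val| (max |(i₁.val : ℤ) - j₂.val|
    (max |(i₂.val : ℤ) - j₁.val| (max |(i₂.val : ℤ) - j₂.val| |(j₁.val : ℤ) - j₂.val|))))

end FockMPO

namespace FockMPO

/-! Explicit operator. For fixed configurations `α`, `β` the cores become real matrices, and an MPO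
entry is a product of them starting from a row vector with the single entry 1. So it suffices to
guess the row vector at each cut and check that every core carries it to the next
(`MPO.toMatrix_eq_of_propagate`). In the left half, `leftVec` is this guess: each label names the
part to the left of the cut of a string `a_{i₁}* a_{i₂}* a_{j₁} a_{j₂}`. For `e`, `e*` and `D`,
where three or four operators are already placed, these parts are summed against the coefficients.
Since `a_i` has the factor `S` before its site and `I` after it, a prefix does not see where an
operator behind the cut sits, and passing one site is an identity in the algebra generated by `S`,
`A`, `A*`. In the right half, `rightVec` is `leftVec` contracted with the middle matrix, so the same
recursions apply (`leftVec_succ`, `rightVec_succ`). After the last site the only entry is the sum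
over strings with `i₁ < i₂`, `j₁ < j₂`, which equals the entry of `twoParticle v` by the
anticommutation relations (`twoParticle_apply`).

Finite range. A tensor whose unfoldings all have rank at most `r`, with `r ≥ 1`, has an MPO with
ranks at most `r` (`exists_mpo_of_cutRankLE`). At a given cut, sort the strings by a label that
determines one of the two factors; the number of labels then bounds the rank. For strings with two
operators on each side the label may name either pair. If the left pair reaches further than `P`
from the cut, range `d = P + Q` confines the right pair to the first `Q` orbitals behind it. The
count is `4d - 2 + (2P² - P) + (2Q² - Q)`, and splitting `d` as evenly as possible gives the stated
bounds. -/

open Finset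

/-! ### Path sums and propagated row vectors -/

/-- A sum over rank-index paths telescopes along any family of row vectors propagated by the cores. -/
theorem sum_path_eq {n : ℕ} (B : Fin (n + 1) → Type) [∀ k, Fintype (B k)]
    (c : ∀ k : Fin n, B k.castSucc → B k.succ → ℝ) (u : ∀ k, B k → ℝ)
    (h : ∀ k l', u k.succ l' = ∑ l, u k.castSucc l * c k l l') :
    ∑ j : (∀ k, B k), u 0 (j 0) * ∏ k : Fin n, c k (j k.castSucc) (j k.succ) =
      ∑ l, u (Fin.last n) l := by
  induction n with
  | zero =>
    rw [← (Fin.consEquiv B).sum_comp, Fintype.sum_prod_type]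
    simp [Fin.consEquiv]
  | succ n ih =>
    rw [← (Fin.consEquiv B).sum_comp, Fintype.sum_prod_type_right]
    refine Eq.trans ?_ (ih (fun k => B k.succ) (fun k => c k.succ) (fun k => u k.succ)
      (fun k l' => h k.succ l'))
    refine Finset.sum_congr rfl fun j _ => ?_
    -- Summing out the first rank index turns `u 0` into `u 1`; the remaining path sum is the
    -- induction hypothesis for the shifted family.
    have h0 := h 0 (j 0)
    refine Eq.trans ?_ (congrArg (· * _) h0.symm)
    rw [Finset.sum_mul]
    refine Finset.sum_congr rfl fun x _ => ?_
    rw [Fin.prod_univ_succ, mul_assoc]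
    rfl

theorem MPO.toMatrix_eq_of_propagate {K : ℕ} (M : MPO K) (α β : Fin K → Fin 2)
    (u : ∀ k, M.bond k → ℝ) (h0 : ∀ l, u 0 l = 1)
    (h : ∀ k l', u k.succ l' = ∑ l, u k.castSucc l * M.core k l l' (α k) (β k)) :
    M.toMatrix α β = ∑ l, u (Fin.last K) l := by
  rw [← sum_path_eq M.bond (fun k l l' => M.core k l l' (α k) (β k)) u h]
  simp [MPO.toMatrix, h0]

/-! ### Enumerating labels and bounding the ranks of the explicit operator -/

/-- Labels, sorted by their kind. -/
def labelEquiv (K : ℕ) : Label K ≃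
    (Unit ⊕ Fin K ⊕ Fin K ⊕ (Fin K × Fin K)) ⊕ ((Fin K × Fin K) ⊕ (Fin K × Fin K)) ⊕
      (Fin K ⊕ Fin K ⊕ Unit) where
  toFun
    | .one => .inl (.inl ())
    | .cre i => .inl (.inr (.inl i))
    | .ann i => .inl (.inr (.inr (.inl i)))
    | .num i j => .inl (.inr (.inr (.inr (i, j))))
    | .cre₂ i j => .inr (.inl (.inl (i, j)))
    | .ann₂ i j => .inr (.inl (.inr (i, j)))
    | .e i => .inr (.inr (.inl i))
    | .eStar i => .inr (.inr (.inr (.inl i)))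
    | .full => .inr (.inr (.inr (.inr ())))
  invFun
    | .inl (.inl ()) => .one
    | .inl (.inr (.inl i)) => .cre i
    | .inl (.inr (.inr (.inl i))) => .ann i
    | .inl (.inr (.inr (.inr (i, j)))) => .num i j
    | .inr (.inl (.inl (i, j))) => .cre₂ i j
    | .inr (.inl (.inr (i, j))) => .ann₂ i j
    | .inr (.inr (.inl i)) => .e i
    | .inr (.inr (.inr (.inl i))) => .eStar i
    | .inr (.inr (.inr (.inr ()))) => .full
  left_inv l := by cases l <;> rfl
  right_inv l := by rcases l with (_ | _ | _ | _) | (_ | _) | _ | _ | _ <;> rfl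

theorem sum_label {K : ℕ} {M : Type*} [AddCommMonoid M] (f : Label K → M) :
    ∑ l, f l = (f .one + (∑ i, f (.cre i) + (∑ j, f (.ann j) + ∑ i, ∑ j, f (.num i j)))) +
      ((∑ i, ∑ j, f (.cre₂ i j) + ∑ i, ∑ j, f (.ann₂ i j)) +
      (∑ j, f (.e j) + (∑ i, f (.eStar i) + f .full))) := by
  rw [← (labelEquiv K).symm.sum_comp]
  simp only [Fintype.sum_sum_type, Fintype.sum_prod_type, Finset.univ_unique, sum_singleton]
  rfl

/-- The orbitals in front of the cut `s`. -/
def below (K s : ℕ) : Finset (Fin K) := univ.filter fun i => i.val < s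

/-- The orbitals behind the cut `s`. -/
def above (K s : ℕ) : Finset (Fin K) := univ.filter fun i => s ≤ i.val

@[simp] theorem mem_below {K s : ℕ} {i : Fin K} : i ∈ below K s ↔ i.val < s := by simp [below]

@[simp] theorem mem_above {K s : ℕ} {i : Fin K} : i ∈ above K s ↔ s ≤ i.val := by simp [above]

theorem sum_below_succ {K : ℕ} (k : Fin K) (f : Fin K → ℝ) :
    ∑ i ∈ below K (k + 1), f i = ∑ i ∈ below K k, f i + f k := by
  have : below K (k + 1) = insert k (below K k) := by
    ext i; simp only [mem_below, mem_insert, Fin.ext_iff]; omega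
  rw [this, sum_insert (by simp), add_comm]

theorem card_strict_pairs {K : ℕ} (N : Finset (Fin K)) :
    2 * ((∑ i : Fin K, ∑ j : Fin K, if i ∈ N ∧ j ∈ N ∧ i < j then 1 else 0 : ℕ) : ℤ) =
      (N.card : ℤ) ^ 2 - N.card := by
  have h1 : ∑ i : Fin K, ∑ j : Fin K, (if i ∈ N ∧ j ∈ N ∧ i < j then 1 else 0 : ℕ) =
      ∑ i : Fin K, ∑ j : Fin K, (if i ∈ N ∧ j ∈ N ∧ j < i then 1 else 0 : ℕ) := by
    rw [sum_comm]
    refine sum_congr rfl fun i _ => sum_congr rfl fun j _ => if_congr (by tauto) rfl rfl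
  have h2 : ∑ i : Fin K, ∑ j : Fin K, (if i ∈ N ∧ j ∈ N ∧ i < j then 1 else 0 : ℕ) +
      ∑ i : Fin K, ∑ j : Fin K, (if i ∈ N ∧ j ∈ N ∧ j < i then 1 else 0 : ℕ) +
      ∑ i : Fin K, ∑ j : Fin K, (if i ∈ N ∧ j = i then 1 else 0 : ℕ) =
      ∑ i : Fin K, ∑ j : Fin K, (if i ∈ N then 1 else 0) * (if j ∈ N then 1 else 0) := by
    simp only [← sum_add_distrib]
    refine sum_congr rfl fun i _ => sum_congr rfl fun j _ => ?_
    rcases lt_trichotomy i j with h | h | h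
    · by_cases hi : i ∈ N <;> by_cases hj : j ∈ N <;> simp [hi, hj, h, h.not_gt, h.ne']
    · subst h
      by_cases hi : i ∈ N <;> simp [hi]
    · by_cases hi : i ∈ N <;> by_cases hj : j ∈ N <;> simp [hi, hj, h, h.not_gt, h.ne]
  have h3 : ∑ i : Fin K, ∑ j : Fin K, (if i ∈ N ∧ j = i then 1 else 0 : ℕ) = N.card := by
    simp [ite_and, Finset.sum_ite_irrel]
  rw [← h1, h3, ← Finset.sum_mul_sum] at h2
  have h4 : ∑ i : Fin K, (if i ∈ N then 1 else 0 : ℕ) = N.card := by simp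
  rw [h4] at h2
  have h5 := congrArg (Nat.cast : ℕ → ℤ) h2
  push_cast at h5 ⊢
  linarith

/-- The number of labels whose pair indices stay in two given windows. -/
theorem card_labels_le {K : ℕ} (p : Label K → Prop) [DecidablePred p] (C N N' E : Finset (Fin K))
    (hcre : ∀ i, p (.cre i) → i ∈ C) (hann : ∀ i, p (.ann i) → i ∈ C)
    (hnum : ∀ i j, p (.num i j) → (i ∈ N ∧ j ∈ N) ∨ (i ∈ N' ∧ j ∈ N'))
    (hcre₂ : ∀ i j, p (.cre₂ i j) → (i ∈ N ∧ j ∈ N ∧ i < j) ∨ (i ∈ N' ∧ j ∈ N' ∧ i < j))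
    (hann₂ : ∀ i j, p (.ann₂ i j) → (i ∈ N ∧ j ∈ N ∧ i < j) ∨ (i ∈ N' ∧ j ∈ N' ∧ i < j))
    (he : ∀ i, p (.e i) → i ∈ E) (heStar : ∀ i, p (.eStar i) → i ∈ E) :
    (Fintype.card {l // p l} : ℤ) ≤ 2 + 2 * C.card + 2 * E.card +
      (2 * (N.card : ℤ) ^ 2 - N.card) + (2 * (N'.card : ℤ) ^ 2 - N'.card) := by
  have hcard : Fintype.card {l // p l} = ∑ l : Label K, if p l then 1 else 0 := by
    rw [Fintype.card_subtype, Finset.card_filter]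
  have hone : ∀ l : Label K, (if p l then 1 else 0 : ℕ) ≤ 1 := fun l => by split_ifs <;> simp
  have single : ∀ (g : Fin K → Label K) (S : Finset (Fin K)), (∀ i, p (g i) → i ∈ S) →
      ∑ i, (if p (g i) then 1 else 0 : ℕ) ≤ S.card := by
    intro g S h
    have : S.card = ∑ i, (if i ∈ S then 1 else 0 : ℕ) := by simp
    rw [this]
    refine sum_le_sum fun i _ => ?_
    by_cases hi : p (g i)
    · simp [hi, h i hi]
    · simp [hi]
  have double : ∀ (g : Fin K → Fin K → Label K) (r r' : Fin K → Fin K → Prop)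
      [DecidableRel r] [DecidableRel r'], (∀ i j, p (g i j) → r i j ∨ r' i j) →
      ∑ i, ∑ j, (if p (g i j) then 1 else 0 : ℕ) ≤
        ∑ i, ∑ j, (if r i j then 1 else 0) + ∑ i, ∑ j, (if r' i j then 1 else 0) := by
    intro g r r' _ _ h
    simp only [← sum_add_distrib]
    refine sum_le_sum fun i _ => sum_le_sum fun j _ => ?_
    by_cases hi : p (g i j)
    · rcases h i j hi with h | h <;> simp [hi, h]
    · simp [hi]
  have hsq : ∀ S : Finset (Fin K),
      ∑ i, ∑ j, (if i ∈ S ∧ j ∈ S then 1 else 0 : ℕ) = S.card ^ 2 := by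
    intro S
    simp [ite_and, sq, Finset.sum_ite_irrel]
  -- Each window of size `n` contributes `n²` labels `num` and `n(n-1)/2` each of `cre₂` and `ann₂`,
  -- hence `2n² - n` in total.
  have hn := double _ (fun i j => i ∈ N ∧ j ∈ N) (fun i j => i ∈ N' ∧ j ∈ N') hnum
  have hc := double _ (fun i j => i ∈ N ∧ j ∈ N ∧ i < j) (fun i j => i ∈ N' ∧ j ∈ N' ∧ i < j) hcre₂
  have ha := double _ (fun i j => i ∈ N ∧ j ∈ N ∧ i < j) (fun i j => i ∈ N' ∧ j ∈ N' ∧ i < j) hann₂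
  rw [hsq, hsq] at hn
  have := card_strict_pairs N
  have := card_strict_pairs N'
  have h1 := single _ _ hcre
  have h2 := single _ _ hann
  have h3 := single _ _ he
  have h4 := single _ _ heStar
  have h5 := hone .one
  have h6 := hone .full
  rw [hcard, sum_label]
  zify at *
  linarith

theorem card_below (K s : ℕ) : (below K s).card ≤ s := by
  have h : ((below K s).image Fin.val) ⊆ range s := by
    intro x; simp only [mem_image, mem_below, mem_range]; rintro ⟨i, h, rfl⟩; exact h
  simpa [card_image_of_injective _ Fin.val_injective] using card_le_card h

theorem card_above (K s : ℕ) : (above K s).card ≤ K - s := by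
  have h : ((above K s).image Fin.val) ⊆ Finset.Ico s K := by
    intro x; simp only [mem_image, mem_above, Finset.mem_Ico]; rintro ⟨i, h, rfl⟩; exact ⟨h, i.2⟩
  simpa [card_image_of_injective _ Fin.val_injective] using card_le_card h

/-- At every cut the labels `cre`, `ann`, `e`, `eStar` together number at most `2K`, since the first
two kinds use the orbitals on one side and the last two those on the other. Only the pair labels
depend on the cut, and their side has at most `K / 2` orbitals. -/
theorem explicitMPO_rank_le {K : ℕ} (hK : 2 ≤ K) (hEven : Even K)
    (v : Fin K → Fin K → Fin K → Fin K → ℝ) (k : Fin (K + 1)) :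
    ((explicitMPO hK v).rank k : ℝ) ≤ (K : ℝ) ^ 2 / 2 + 3 * (K : ℝ) / 2 + 2 := by
  obtain ⟨m, rfl⟩ := hEven
  have hm : (m + m) / 2 = m := by omega
  -- Here `s` is the number of sites on the short side of the cut, and `n` bounds the orbitals
  -- available to pair labels. Only one window is needed, so the second one is empty.
  obtain ⟨s, n, hs, h⟩ : ∃ s n : ℕ, s ≤ m ∧ n ≤ s ∧
      (Fintype.card {l : Label (m + m) // IsBond (m + m) k.val l} : ℤ) ≤
        2 + 2 * s + 2 * (2 * m - s) + (2 * (n : ℤ) ^ 2 - n) := by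
    have hb := card_below (m + m) k
    have ha := card_above (m + m) k
    by_cases hk : k.val < m
    · refine ⟨k, (below (m + m) k).card, hk.le, hb, ?_⟩
      have h := card_labels_le (IsBond (m + m) k.val) (below (m + m) k) (below (m + m) k) ∅
        (above (m + m) k)
        (by simp [IsBond, hm, hk, IsLeft]) (by simp [IsBond, hm, hk, IsLeft])
        (by simp [IsBond, hm, hk, IsLeft])
        (by simp only [IsBond, hm, hk, if_true, IsLeft, mem_below]; omega)
        (by simp only [IsBond, hm, hk, if_true, IsLeft, mem_below]; omega)
        (by simp [IsBond, hm, hk, IsLeft]) (by simp [IsBond, hm, hk, IsLeft])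
      simp only [card_empty] at h
      push_cast at h
      have ha' : ((above (m + m) k).card : ℤ) ≤ 2 * m - k := by omega
      linarith [(Nat.cast_le (α := ℤ)).2 hb]
    · have := k.2
      refine ⟨m + m - k, (above (m + m) k).card, by omega, ha, ?_⟩
      have h := card_labels_le (IsBond (m + m) k.val) (above (m + m) k) (above (m + m) k) ∅
        (below (m + m) k)
        (by simp [IsBond, hm, hk, IsRight]) (by simp [IsBond, hm, hk, IsRight])
        (by simp [IsBond, hm, hk, IsRight])
        (by simp only [IsBond, hm, hk, if_false, IsRight, mem_above]; omega)
        (by simp only [IsBond, hm, hk, if_false, IsRight, mem_above]; omega)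
        (by simp [IsBond, hm, hk, IsRight]) (by simp [IsBond, hm, hk, IsRight])
      simp only [card_empty] at h
      push_cast at h
      omega
  have hr : (explicitMPO hK v).rank k =
      Fintype.card {l : Label (m + m) // IsBond (m + m) k.val l} := by
    unfold MPO.rank
    exact Fintype.card_congr (Equiv.refl _)
  rw [hr]
  have h' := (Int.cast_le (R := ℝ)).2 h.2
  push_cast at h' ⊢
  have hn : (n : ℝ) ≤ m := by exact_mod_cast h.1.trans hs
  -- This product is `(2m² - m) - (2n² - n)`.
  have hn1 : 0 ≤ ((m : ℝ) - n) * (2 * (m + n) - 1) := by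
    rcases Nat.eq_zero_or_pos m with h0 | h0
    · omega
    · have : (1 : ℝ) ≤ m := by exact_mod_cast h0
      have : (0 : ℝ) ≤ n := Nat.cast_nonneg n
      exact mul_nonneg (by linarith) (by linarith)
  nlinarith

/-! ### One-site factors and prefixes of operator strings -/

/-- The factor at site `k` of the annihilation operator `a_i`; it is `S` at all sites in front of `i`. -/
def siteOp (i k : ℕ) : Matrix (Fin 2) (Fin 2) ℝ :=
  if k < i then matS else if k = i then matA else 1

/-- The factor at site `k` of `a_{i₁}* a_{i₂}* a_{j₁} a_{j₂}`. -/
def stringSite (i₁ i₂ j₁ j₂ k : ℕ) : Matrix (Fin 2) (Fin 2) ℝ :=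
  (siteOp i₁ k).transpose * (siteOp i₂ k).transpose * siteOp j₁ k * siteOp j₂ k

/-- The part of an entry of `a_{i₁}* a_{i₂}* a_{j₁} a_{j₂}` contributed by the sites `< s`. -/
def stringPrefix (α β : ℕ → Fin 2) (s i₁ i₂ j₁ j₂ : ℕ) : ℝ :=
  ∏ k ∈ range s, stringSite i₁ i₂ j₁ j₂ k (α k) (β k)

theorem siteOp_of_lt {i k : ℕ} (h : k < i) : siteOp i k = matS := by simp [siteOp, h]

theorem siteOp_self (k : ℕ) : siteOp k k = matA := by simp [siteOp]

theorem siteOp_of_gt {i k : ℕ} (h : i < k) : siteOp i k = 1 := by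
  simp [siteOp, h.not_gt, h.ne']

section Prefix

variable (α β : ℕ → Fin 2)

/-- The sites in front of a cut do not distinguish orbitals behind it. -/
theorem stringPrefix_congr {s a b c d a' b' c' d' : ℕ} (ha : a = a' ∨ s ≤ a ∧ s ≤ a')
    (hb : b = b' ∨ s ≤ b ∧ s ≤ b') (hc : c = c' ∨ s ≤ c ∧ s ≤ c') (hd : d = d' ∨ s ≤ d ∧ s ≤ d') :
    stringPrefix α β s a b c d = stringPrefix α β s a' b' c' d' := by
  have key : ∀ {x x' k : ℕ}, (x = x' ∨ s ≤ x ∧ s ≤ x') → k < s → siteOp x k = siteOp x' k := by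
    rintro x x' k (rfl | ⟨h, h'⟩) hk
    · rfl
    · rw [siteOp_of_lt (by omega), siteOp_of_lt (by omega)]
  refine prod_congr rfl fun k hk => ?_
  rw [mem_range] at hk
  simp only [stringSite, key ha hk, key hb hk, key hc hk, key hd hk]

/-- Used with `K` in place of an index equal to `s`: in front of site `s`, an operator acting at `s`
is indistinguishable from one acting later. All signs come from simplifying the one-site product to
`M`. -/
theorem stringPrefix_step (s a b c d a' b' c' d' : ℕ) (M : Matrix (Fin 2) (Fin 2) ℝ)
    (hM : stringSite a b c d s = M)
    (ha : a = a' ∨ s ≤ a ∧ s ≤ a') (hb : b = b' ∨ s ≤ b ∧ s ≤ b') (hc : c = c' ∨ s ≤ c ∧ s ≤ c')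
    (hd : d = d' ∨ s ≤ d ∧ s ≤ d') :
    stringPrefix α β (s + 1) a b c d = stringPrefix α β s a' b' c' d' * M (α s) (β s) := by
  rw [← stringPrefix_congr α β ha hb hc hd, stringPrefix, prod_range_succ, hM]
  rfl

end Prefix

theorem matS_transpose : matS.transpose = matS := by
  ext i j; fin_cases i <;> fin_cases j <;> simp [matS]

theorem matS_mul_matS : matS * matS = 1 := by
  ext i j; fin_cases i <;> fin_cases j <;> simp [matS, Matrix.mul_apply]

theorem matA_mul_matS : matA * matS = -matA := by
  ext i j; fin_cases i <;> fin_cases j <;> simp [matS, matA, Matrix.mul_apply]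

theorem matS_mul_matA : matS * matA = matA := by
  ext i j; fin_cases i <;> fin_cases j <;> simp [matS, matA, Matrix.mul_apply]

theorem matAT_mul_matS : matA.transpose * matS = matA.transpose := by
  ext i j; fin_cases i <;> fin_cases j <;> simp [matS, matA, Matrix.mul_apply]

theorem matS_mul_matAT : matS * matA.transpose = -matA.transpose := by
  ext i j; fin_cases i <;> fin_cases j <;> simp [matS, matA, Matrix.mul_apply]

theorem matAT_mul_matA_mul_matS :
    matA.transpose * matA * matS = -(matA.transpose * matA) := by
  rw [Matrix.mul_assoc, matA_mul_matS, mul_neg]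

/-! ### Recursions for the left row vectors -/

/-- The row vectors propagated by the left cores: the label `l` at cut `s` names a combination of
prefixes of strings of creators and annihilators. An index `K` stands for an orbital behind the
cut. -/
def leftVec {K : ℕ} (w : Fin K → Fin K → Fin K → Fin K → ℝ) (α β : ℕ → Fin 2) (s : ℕ) :
    Label K → ℝ
  | .one => stringPrefix α β s K K K K
  | .cre i => stringPrefix α β s i K K K
  | .ann j => -stringPrefix α β s K K j K
  | .num i j => -stringPrefix α β s i K j K
  | .cre₂ i₁ i₂ => stringPrefix α β s i₁ i₂ K K
  | .ann₂ j₁ j₂ => -stringPrefix α β s K K j₁ j₂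
  | .e j => ∑ i₂ ∈ below K s, ∑ i₁ ∈ below K i₂, ∑ j₁ ∈ below K s,
      w i₁ i₂ j₁ j * -stringPrefix α β s i₁ i₂ j₁ K
  | .eStar i => ∑ j₂ ∈ below K s, ∑ j₁ ∈ below K j₂, ∑ i₁ ∈ below K s,
      w i₁ i j₁ j₂ * -stringPrefix α β s i₁ K j₁ j₂
  | .full => ∑ i₂ ∈ below K s, ∑ i₁ ∈ below K i₂, ∑ j₂ ∈ below K s, ∑ j₁ ∈ below K j₂,
      w i₁ i₂ j₁ j₂ * -stringPrefix α β s i₁ i₂ j₁ j₂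

section Recursion

variable {K : ℕ} (w : Fin K → Fin K → Fin K → Fin K → ℝ) (α β : ℕ → Fin 2) (k : Fin K)

attribute [local simp] stringSite siteOp_of_lt siteOp_self siteOp_of_gt matS_transpose matS_mul_matS
  matA_mul_matS matS_mul_matA matAT_mul_matS matS_mul_matAT matAT_mul_matA_mul_matS

theorem leftVec_one :
    leftVec w α β (k + 1) .one =
      leftVec w α β k .one * (1 : Matrix (Fin 2) (Fin 2) ℝ) (α k) (β k) := by
  have := k.2
  simp only [leftVec]
  rw [stringPrefix_step α β k K K K K K K K K 1
    (by simp [*]) (by omega) (by omega) (by omega) (by omega)]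

theorem leftVec_cre_self :
    leftVec w α β (k + 1) (.cre k) = leftVec w α β k .one * matA.transpose (α k) (β k) := by
  have := k.2
  simp only [leftVec]
  rw [stringPrefix_step α β k k K K K K K K K matA.transpose
    (by simp [*]) (by omega) (by omega) (by omega) (by omega)]

theorem leftVec_cre {i : Fin K} (hi : i.val < k) :
    leftVec w α β (k + 1) (.cre i) = leftVec w α β k (.cre i) * matS (α k) (β k) := by
  have := k.2
  simp only [leftVec]
  rw [stringPrefix_step α β k i K K K i K K K matS
    (by simp [*]) (by omega) (by omega) (by omega) (by omega)]

theorem leftVec_ann_self :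
    leftVec w α β (k + 1) (.ann k) = leftVec w α β k .one * matA (α k) (β k) := by
  have := k.2
  simp only [leftVec]
  -- The factor of the later annihilator at this site is `matS`, and `matA * matS = -matA`. This
  -- single sign, met once by every `j₁`, explains both the minus signs in `leftVec` and the use of
  -- `-vTilde` as coefficients.
  rw [stringPrefix_step α β k K K k K K K K K (-matA)
    (by simp [*]) (by omega) (by omega) (by omega) (by omega)]
  simp

theorem leftVec_ann {j : Fin K} (hj : j.val < k) :
    leftVec w α β (k + 1) (.ann j) = leftVec w α β k (.ann j) * matS (α k) (β k) := by
  have := k.2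
  simp only [leftVec]
  rw [stringPrefix_step α β k K K j K K K j K matS
    (by simp [*]) (by omega) (by omega) (by omega) (by omega)]
  simp

theorem leftVec_num_self :
    leftVec w α β (k + 1) (.num k k) =
      leftVec w α β k .one * (matA.transpose * matA) (α k) (β k) := by
  have := k.2
  simp only [leftVec]
  rw [stringPrefix_step α β k k K k K K K K K (-(matA.transpose * matA))
    (by simp [*]) (by omega) (by omega) (by omega) (by omega)]
  simp

theorem leftVec_num_right {i : Fin K} (hi : i.val < k) :
    leftVec w α β (k + 1) (.num i k) = leftVec w α β k (.cre i) * matA (α k) (β k) := by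
  have := k.2
  simp only [leftVec]
  rw [stringPrefix_step α β k i K k K i K K K (-matA)
    (by simp [*]) (by omega) (by omega) (by omega) (by omega)]
  simp

theorem leftVec_num_left {j : Fin K} (hj : j.val < k) :
    leftVec w α β (k + 1) (.num k j) = leftVec w α β k (.ann j) * matA.transpose (α k) (β k) := by
  have := k.2
  simp only [leftVec]
  rw [stringPrefix_step α β k k K j K K K j K matA.transpose
    (by simp [*]) (by omega) (by omega) (by omega) (by omega)]
  simp

theorem leftVec_num {i : Fin K} (hi : i.val < k) {j : Fin K} (hj : j.val < k) :
    leftVec w α β (k + 1) (.num i j) =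
      leftVec w α β k (.num i j) * (1 : Matrix (Fin 2) (Fin 2) ℝ) (α k) (β k) := by
  have := k.2
  simp only [leftVec]
  rw [stringPrefix_step α β k i K j K i K j K 1
    (by simp [*]) (by omega) (by omega) (by omega) (by omega)]
  simp

theorem leftVec_cre₂_right {i : Fin K} (hi : i.val < k) :
    leftVec w α β (k + 1) (.cre₂ i k) = leftVec w α β k (.cre i) * matA.transpose (α k) (β k) := by
  have := k.2
  simp only [leftVec]
  rw [stringPrefix_step α β k i k K K i K K K matA.transpose
    (by simp [*]) (by omega) (by omega) (by omega) (by omega)]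

theorem leftVec_cre₂ {i : Fin K} (hi : i.val < k) {j : Fin K} (hj : j.val < k) :
    leftVec w α β (k + 1) (.cre₂ i j) =
      leftVec w α β k (.cre₂ i j) * (1 : Matrix (Fin 2) (Fin 2) ℝ) (α k) (β k) := by
  have := k.2
  simp only [leftVec]
  rw [stringPrefix_step α β k i j K K i j K K 1
    (by simp [*]) (by omega) (by omega) (by omega) (by omega)]

theorem leftVec_ann₂_right {j : Fin K} (hj : j.val < k) :
    leftVec w α β (k + 1) (.ann₂ j k) = leftVec w α β k (.ann j) * matA (α k) (β k) := by
  have := k.2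
  simp only [leftVec]
  rw [stringPrefix_step α β k K K j k K K j K matA
    (by simp [*]) (by omega) (by omega) (by omega) (by omega)]
  simp

theorem leftVec_ann₂ {i : Fin K} (hi : i.val < k) {j : Fin K} (hj : j.val < k) :
    leftVec w α β (k + 1) (.ann₂ i j) =
      leftVec w α β k (.ann₂ i j) * (1 : Matrix (Fin 2) (Fin 2) ℝ) (α k) (β k) := by
  have := k.2
  simp only [leftVec]
  rw [stringPrefix_step α β k K K i j K K i j 1
    (by simp [*]) (by omega) (by omega) (by omega) (by omega)]
  simp

/-- Among the three placed operators only `i₂` and `j₁` can act at the new site `k`, because `i₁ <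
i₂`. The four terms correspond to neither, `i₂` alone, `j₁` alone, or both acting there. -/
theorem leftVec_e (j : Fin K) :
    leftVec w α β (k + 1) (.e j) = leftVec w α β k (.e j) * matS (α k) (β k) +
      ∑ i₁ ∈ below K k, ∑ j₁ ∈ below K k,
        leftVec w α β k (.num i₁ j₁) * (w i₁ k j₁ j * matA.transpose (α k) (β k)) +
      (∑ i₂ ∈ below K k, ∑ i₁ ∈ below K i₂,
        leftVec w α β k (.cre₂ i₁ i₂) * (w i₁ i₂ k j * matA (α k) (β k)) +
      ∑ i₁ ∈ below K k,
        leftVec w α β k (.cre i₁) * (w i₁ k k j * (matA.transpose * matA) (α k) (β k))) := by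
  have := k.2
  simp only [leftVec, sum_below_succ, sum_add_distrib]
  congr 1
  congr 1
  rotate_left 2
  congr 1
  rotate_left 2
  · simp only [sum_mul]
    refine sum_congr rfl fun i₂ hi₂ => sum_congr rfl fun i₁ hi₁ => sum_congr rfl fun j₁ hj₁ => ?_
    simp only [mem_below] at hi₂ hi₁ hj₁
    have hi₁' : i₁.val < k := by omega
    rw [stringPrefix_step α β k i₁ i₂ j₁ K i₁ i₂ j₁ K matS
      (by simp [*]) (by omega) (by omega) (by omega) (by omega)]
    ring
  · refine sum_congr rfl fun i₁ hi₁ => sum_congr rfl fun j₁ hj₁ => ?_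
    simp only [mem_below] at hi₁ hj₁
    rw [stringPrefix_step α β k i₁ k j₁ K i₁ K j₁ K matA.transpose
      (by simp [*]) (by omega) (by omega) (by omega) (by omega)]
    ring
  · refine sum_congr rfl fun i₂ hi₂ => sum_congr rfl fun i₁ hi₁ => ?_
    simp only [mem_below] at hi₂ hi₁
    have hi₁' : i₁.val < k := by omega
    rw [stringPrefix_step α β k i₁ i₂ k K i₁ i₂ K K (-matA)
      (by simp [*]) (by omega) (by omega) (by omega) (by omega)]
    simp only [Matrix.neg_apply]
    ring
  · refine sum_congr rfl fun i₁ hi₁ => ?_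
    simp only [mem_below] at hi₁
    rw [stringPrefix_step α β k i₁ k k K i₁ K K K (-(matA.transpose * matA))
      (by simp [*]) (by omega) (by omega) (by omega) (by omega)]
    simp only [Matrix.neg_apply]
    ring

/-- The mirror case: `j₁ < j₂` leaves only `j₂` and `i₁` as candidates for the new site. -/
theorem leftVec_eStar (i : Fin K) :
    leftVec w α β (k + 1) (.eStar i) = leftVec w α β k (.eStar i) * matS (α k) (β k) +
      ∑ i₁ ∈ below K k, ∑ j₁ ∈ below K k,
        leftVec w α β k (.num i₁ j₁) * (w i₁ i j₁ k * matA (α k) (β k)) +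
      (∑ j₂ ∈ below K k, ∑ j₁ ∈ below K j₂,
        leftVec w α β k (.ann₂ j₁ j₂) * (w k i j₁ j₂ * matA.transpose (α k) (β k)) +
      ∑ j₁ ∈ below K k,
        leftVec w α β k (.ann j₁) * (w k i j₁ k * (matA.transpose * matA) (α k) (β k))) := by
  have := k.2
  simp only [leftVec, sum_below_succ, sum_add_distrib]
  congr 1
  congr 1
  rotate_left 2
  congr 1
  rotate_left 2
  · simp only [sum_mul]
    refine sum_congr rfl fun j₂ hj₂ => sum_congr rfl fun j₁ hj₁ => sum_congr rfl fun i₁ hi₁ => ?_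
    simp only [mem_below] at hj₂ hj₁ hi₁
    have hj₁' : j₁.val < k := by omega
    rw [stringPrefix_step α β k i₁ K j₁ j₂ i₁ K j₁ j₂ matS
      (by simp [*]) (by omega) (by omega) (by omega) (by omega)]
    ring
  · rw [sum_comm]
    refine sum_congr rfl fun i₁ hi₁ => sum_congr rfl fun j₁ hj₁ => ?_
    simp only [mem_below] at hi₁ hj₁
    rw [stringPrefix_step α β k i₁ K j₁ k i₁ K j₁ K matA
      (by simp [*]) (by omega) (by omega) (by omega) (by omega)]
    ring
  · refine sum_congr rfl fun j₂ hj₂ => sum_congr rfl fun j₁ hj₁ => ?_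
    simp only [mem_below] at hj₂ hj₁
    have hj₁' : j₁.val < k := by omega
    rw [stringPrefix_step α β k k K j₁ j₂ K K j₁ j₂ matA.transpose
      (by simp [*]) (by omega) (by omega) (by omega) (by omega)]
    ring
  · refine sum_congr rfl fun j₁ hj₁ => ?_
    simp only [mem_below] at hj₁
    rw [stringPrefix_step α β k k K j₁ k K K j₁ K (matA.transpose * matA)
      (by simp [*]) (by omega) (by omega) (by omega) (by omega)]
    ring

/-- Here the larger indices `i₂` and `j₂` are the candidates for the new site. The strings with
exactly one of them there have their other three operators already collected in `eStar k` or `e k`.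
-/
theorem leftVec_full :
    leftVec w α β (k + 1) .full =
      leftVec w α β k .full * (1 : Matrix (Fin 2) (Fin 2) ℝ) (α k) (β k) +
      leftVec w α β k (.eStar k) * matA.transpose (α k) (β k) +
      (leftVec w α β k (.e k) * matA (α k) (β k) +
      ∑ i₁ ∈ below K k, ∑ j₁ ∈ below K k,
        leftVec w α β k (.num i₁ j₁) * (w i₁ k j₁ k * (matA.transpose * matA) (α k) (β k))) := by
  have := k.2
  simp only [leftVec, sum_below_succ, sum_add_distrib]
  congr 1
  congr 1
  rotate_left 2
  congr 1
  rotate_left 2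
  · simp only [sum_mul]
    refine sum_congr rfl fun i₂ hi₂ => sum_congr rfl fun i₁ hi₁ => sum_congr rfl fun j₂ hj₂ =>
      sum_congr rfl fun j₁ hj₁ => ?_
    simp only [mem_below] at hi₂ hi₁ hj₂ hj₁
    have hi₁' : i₁.val < k := by omega
    have hj₁' : j₁.val < k := by omega
    rw [stringPrefix_step α β k i₁ i₂ j₁ j₂ i₁ i₂ j₁ j₂ 1
      (by simp [*]) (by omega) (by omega) (by omega) (by omega)]
    ring
  · rw [sum_comm]
    simp only [sum_mul]
    rw [sum_congr rfl fun j₂ _ => sum_comm]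
    refine sum_congr rfl fun j₂ hj₂ => sum_congr rfl fun j₁ hj₁ => sum_congr rfl fun i₁ hi₁ => ?_
    simp only [mem_below] at hj₂ hj₁ hi₁
    have hj₁' : j₁.val < k := by omega
    rw [stringPrefix_step α β k i₁ k j₁ j₂ i₁ K j₁ j₂ matA.transpose
      (by simp [*]) (by omega) (by omega) (by omega) (by omega)]
    ring
  · simp only [sum_mul]
    refine sum_congr rfl fun i₂ hi₂ => sum_congr rfl fun i₁ hi₁ => sum_congr rfl fun j₁ hj₁ => ?_
    simp only [mem_below] at hi₂ hi₁ hj₁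
    have hi₁' : i₁.val < k := by omega
    rw [stringPrefix_step α β k i₁ i₂ j₁ k i₁ i₂ j₁ K matA
      (by simp [*]) (by omega) (by omega) (by omega) (by omega)]
    ring
  · refine sum_congr rfl fun i₁ hi₁ => sum_congr rfl fun j₁ hj₁ => ?_
    simp only [mem_below] at hi₁ hj₁
    rw [stringPrefix_step α β k i₁ k j₁ k i₁ K j₁ K (matA.transpose * matA)
      (by simp [*]) (by omega) (by omega) (by omega) (by omega)]
    ring

end Recursion

/-! ### Sums over the labels present at a cut -/

section Labels

variable {K : ℕ}

theorem sum_isLeft (s : ℕ) (f : Label K → ℝ) :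
    ∑ l : {l : Label K // IsLeft s l}, f l.1 =
      (f .one + (∑ i ∈ below K s, f (.cre i) + (∑ j ∈ below K s, f (.ann j) +
        ∑ i ∈ below K s, ∑ j ∈ below K s, f (.num i j)))) +
      ((∑ i₂ ∈ below K s, ∑ i₁ ∈ below K i₂, f (.cre₂ i₁ i₂) +
        ∑ j₂ ∈ below K s, ∑ j₁ ∈ below K j₂, f (.ann₂ j₁ j₂)) +
      if 2 ≤ s then ∑ j ∈ above K s, f (.e j) + (∑ i ∈ above K s, f (.eStar i) + f .full) else 0) := by
  have pairs : ∀ g : Fin K → Fin K → ℝ,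
      ∑ i₁, ∑ i₂, (if i₁ < i₂ ∧ i₂.val < s then g i₁ i₂ else 0) =
        ∑ i₂ ∈ below K s, ∑ i₁ ∈ below K i₂, g i₁ i₂ := by
    intro g
    rw [sum_comm]
    simp only [below, sum_filter]
    refine sum_congr rfl fun i₂ _ => ?_
    by_cases h : i₂.val < s <;> simp [h]
  rw [← Finset.sum_subtype (univ.filter (IsLeft s)) (by simp) f, sum_filter, sum_label]
  simp only [IsLeft, pairs]
  congr 1
  · simp [below, sum_filter, ite_and, Finset.sum_ite_irrel]
  · congr 1
    split_ifs with h <;> simp [above, sum_filter, h]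

theorem sum_isRight (s : ℕ) (f : Label K → ℝ) :
    ∑ l : {l : Label K // IsRight s l}, f l.1 =
      (f .one + (∑ i ∈ above K s, f (.cre i) + (∑ j ∈ above K s, f (.ann j) +
        ∑ i ∈ above K s, ∑ j ∈ above K s, f (.num i j)))) +
      ((∑ i₁ ∈ above K s, ∑ i₂ ∈ above K (i₁ + 1), f (.cre₂ i₁ i₂) +
        ∑ j₁ ∈ above K s, ∑ j₂ ∈ above K (j₁ + 1), f (.ann₂ j₁ j₂)) +
      if s + 2 ≤ K then
        ∑ j ∈ below K s, f (.e j) + (∑ i ∈ below K s, f (.eStar i) + f .full) else 0) := by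
  have pairs : ∀ g : Fin K → Fin K → ℝ,
      ∑ i₁, ∑ i₂, (if s ≤ i₁.val ∧ i₁ < i₂ then g i₁ i₂ else 0) =
        ∑ i₁ ∈ above K s, ∑ i₂ ∈ above K (i₁ + 1), g i₁ i₂ := by
    intro g
    simp only [above, sum_filter]
    refine sum_congr rfl fun i₂ _ => ?_
    by_cases h : s ≤ i₂.val <;> simp [h, Fin.lt_def, -Fin.val_fin_lt]
  rw [← Finset.sum_subtype (univ.filter (IsRight s)) (by simp) f, sum_filter, sum_label]
  simp only [IsRight, pairs]
  congr 1
  · simp [above, sum_filter, ite_and, Finset.sum_ite_irrel]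
  · congr 1
    split_ifs with h <;> simp [below, sum_filter, h]


end Labels

/-! ### Propagation through the left cores, the middle matrix and the right cores -/

section LeftHalf

variable {K : ℕ} (w : Fin K → Fin K → Fin K → Fin K → ℝ) (α β : ℕ → Fin 2) (k : Fin K)

theorem sum_below_below_eq_zero {s : ℕ} (hs : s < 2) (f : Fin K → Fin K → ℝ) :
    ∑ i₂ ∈ below K s, ∑ i₁ ∈ below K i₂, f i₁ i₂ = 0 := by
  refine sum_eq_zero fun i₂ h₂ => sum_eq_zero fun i₁ h₁ => ?_
  simp only [mem_below] at h₁ h₂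
  omega

/-- Each of these sums needs two distinct orbitals of one kind in front of the cut. Hence omitting
the labels `e`, `eStar`, `full` from the bonds with `s < 2` loses nothing. -/
theorem leftVec_of_lt_two {s : ℕ} (hs : s < 2) :
    (∀ j, leftVec w α β s (.e j) = 0) ∧ (∀ i, leftVec w α β s (.eStar i) = 0) ∧
      leftVec w α β s .full = 0 := by
  simp only [leftVec]
  refine ⟨fun j => ?_, fun i => ?_, ?_⟩ <;> exact sum_below_below_eq_zero hs _

theorem sum_leftVec (s : ℕ) (c : Label K → ℝ) :
    ∑ l : {l : Label K // IsLeft s l}, leftVec w α β s l.1 * c l.1 =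
      (leftVec w α β s .one * c .one + (∑ i ∈ below K s, leftVec w α β s (.cre i) * c (.cre i) +
        (∑ j ∈ below K s, leftVec w α β s (.ann j) * c (.ann j) +
        ∑ i ∈ below K s, ∑ j ∈ below K s, leftVec w α β s (.num i j) * c (.num i j)))) +
      ((∑ i₂ ∈ below K s, ∑ i₁ ∈ below K i₂, leftVec w α β s (.cre₂ i₁ i₂) * c (.cre₂ i₁ i₂) +
        ∑ j₂ ∈ below K s, ∑ j₁ ∈ below K j₂, leftVec w α β s (.ann₂ j₁ j₂) * c (.ann₂ j₁ j₂)) +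
      (∑ j ∈ above K s, leftVec w α β s (.e j) * c (.e j) +
        (∑ i ∈ above K s, leftVec w α β s (.eStar i) * c (.eStar i) +
        leftVec w α β s .full * c .full))) := by
  rw [sum_isLeft s fun l => leftVec w α β s l * c l]
  split_ifs with h
  · rfl
  · obtain ⟨h1, h2, h3⟩ := leftVec_of_lt_two w α β (not_le.1 h)
    simp [h1, h2, h3]

theorem ite_entry {c : Prop} [Decidable c] (M N : Matrix (Fin 2) (Fin 2) ℝ) (a b : Fin 2) :
    (if c then M else N) a b = if c then M a b else N a b := by split_ifs <;> rfl

theorem sum_pair_ite (S : Finset (Fin K)) (T : Fin K → Finset (Fin K)) (a b : Fin K)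
    (f : Fin K → Fin K → ℝ) :
    ∑ j ∈ S, ∑ i ∈ T j, (if a = i ∧ b = j then f i j else 0) =
      if b ∈ S ∧ a ∈ T b then f a b else 0 := by
  have h : ∀ j, ∑ i ∈ T j, (if a = i ∧ b = j then f i j else 0) =
      if b = j then (if a ∈ T b then f a b else 0) else 0 := by
    intro j
    by_cases hj : b = j
    · subst hj; simp
    · simp [hj]
  rw [sum_congr rfl fun j _ => h j, Finset.sum_ite_eq, ite_and]

theorem sum_pair_ite' (S : Finset (Fin K)) (T : Fin K → Finset (Fin K)) (a b : Fin K)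
    (f : Fin K → Fin K → ℝ) :
    ∑ j ∈ S, ∑ i ∈ T j, (if b = j ∧ a = i then f i j else 0) =
      if b ∈ S ∧ a ∈ T b then f a b else 0 := by
  simpa only [and_comm] using sum_pair_ite S T a b f

theorem sum_pair_ite_right (S : Finset (Fin K)) (T : Fin K → Finset (Fin K)) (a b : Fin K)
    (f : Fin K → Fin K → ℝ) :
    ∑ j ∈ S, ∑ i ∈ T j, (if j = b ∧ i = a then f i j else 0) =
      if b ∈ S ∧ a ∈ T b then f a b else 0 := by
  simpa only [eq_comm] using sum_pair_ite' S T a b f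

theorem leftVec_succ (l' : Label K) (hl' : IsLeft (k + 1) l') :
    leftVec w α β (k + 1) l' =
      ∑ l : {l : Label K // IsLeft k.val l},
        leftVec w α β k l.1 * leftCore w k l.1 l' (α k) (β k) := by
  rw [sum_leftVec w α β k fun l => leftCore w k l l' (α k) (β k)]
  cases l' with
  | one => simp [leftCore, leftVec_one]
  | cre i =>
    simp only [IsLeft] at hl'
    rcases eq_or_ne i k with rfl | h
    · simp [leftCore, leftVec_cre_self, ite_entry, -Matrix.transpose_apply]
    · have hi : i.val < k := by omega
      simp [leftCore, leftVec_cre, ite_entry, -Matrix.transpose_apply, hi, h]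
  | ann i =>
    simp only [IsLeft] at hl'
    rcases eq_or_ne i k with rfl | h
    · simp [leftCore, leftVec_ann_self, ite_entry, -Matrix.transpose_apply]
    · have hi : i.val < k := by omega
      simp [leftCore, leftVec_ann, ite_entry, -Matrix.transpose_apply, hi, h]
  | num i j =>
    simp only [IsLeft] at hl'
    rcases eq_or_ne i k with rfl | h
    · rcases eq_or_ne j i with rfl | h'
      · simp [leftCore, leftVec_num_self, ite_entry, -Matrix.transpose_apply, ite_and]
      · have hj : j.val < i := by omega
        simp [leftCore, leftVec_num_left, ite_entry, sum_pair_ite', -Matrix.transpose_apply, hj, h']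
    · have hi : i.val < k := by omega
      rcases eq_or_ne j k with rfl | h'
      · simp [leftCore, leftVec_num_right, ite_entry, sum_pair_ite', -Matrix.transpose_apply, hi, h]
      · have hj : j.val < k := by omega
        simp [leftCore, leftVec_num, ite_entry, -Matrix.transpose_apply, hi, h, hj, h', ite_and]
  | cre₂ i j =>
    simp only [IsLeft] at hl'
    rcases eq_or_ne j k with rfl | h'
    · have hi : i.val < j := by omega
      simp [leftCore, leftVec_cre₂_right, ite_entry, sum_pair_ite, -Matrix.transpose_apply, hi]
    · have hj : j.val < k := by omega
      have hi : i.val < k := by omega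
      simp [hl'.1, leftCore, leftVec_cre₂, ite_entry, sum_pair_ite, -Matrix.transpose_apply, hi,
        hj, h']
  | ann₂ i j =>
    simp only [IsLeft] at hl'
    rcases eq_or_ne j k with rfl | h'
    · have hi : i.val < j := by omega
      simp [leftCore, leftVec_ann₂_right, ite_entry, sum_pair_ite, -Matrix.transpose_apply, hi]
    · have hj : j.val < k := by omega
      have hi : i.val < k := by omega
      simp [hl'.1, leftCore, leftVec_ann₂, ite_entry, sum_pair_ite, -Matrix.transpose_apply, hi,
        hj, h']
  | e j =>
    simp only [IsLeft] at hl'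
    have hj' : k.val ≤ j := by omega
    simp [leftCore, leftVec_e, ite_entry, -Matrix.transpose_apply, hj']
    ring
  | eStar j =>
    simp only [IsLeft] at hl'
    have hj' : k.val ≤ j := by omega
    simp [leftCore, leftVec_eStar, ite_entry, -Matrix.transpose_apply, hj']
    ring
  | full =>
    simp [leftCore, leftVec_full, ite_entry, -Matrix.transpose_apply]
    ring

/-- The row vectors propagated by the right cores: those of the left half, multiplied by the middle
matrix. -/
def rightVec (s : ℕ) : Label K → ℝ
  | .one => leftVec w α β s .full
  | .cre i => leftVec w α β s (.eStar i)
  | .ann j => leftVec w α β s (.e j)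
  | .num i₂ j₂ => ∑ i₁ ∈ below K s, ∑ j₁ ∈ below K s, leftVec w α β s (.num i₁ j₁) * w i₁ i₂ j₁ j₂
  | .cre₂ i₁ i₂ =>
      ∑ j₂ ∈ below K s, ∑ j₁ ∈ below K j₂, leftVec w α β s (.ann₂ j₁ j₂) * w i₁ i₂ j₁ j₂
  | .ann₂ j₁ j₂ =>
      ∑ i₂ ∈ below K s, ∑ i₁ ∈ below K i₂, leftVec w α β s (.cre₂ i₁ i₂) * w i₁ i₂ j₁ j₂
  | .e j => leftVec w α β s (.ann j)
  | .eStar i => leftVec w α β s (.cre i)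
  | .full => leftVec w α β s .one

theorem sum_leftVec_mul_midMatrix (s : ℕ) (l : Label K) (hl : IsRight s l) :
    ∑ m : {m : Label K // IsLeft s m}, leftVec w α β s m.1 * midMatrix w m.1 l =
      rightVec w α β s l := by
  rw [sum_leftVec w α β s fun m => midMatrix w m l]
  cases l <;> simp only [IsRight] at hl <;> simp [midMatrix, rightVec, hl]

/-- For a right-half label `num`, the coefficient slice has already been contracted with all pairs
on the left. The growth of that contraction supplies the column of `rightCore`; the next two lemmas
serve `ann₂` and `cre₂`. -/
theorem sum_leftVec_num_succ (c : Fin K → Fin K → ℝ) :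
    ∑ i ∈ below K (k + 1), ∑ j ∈ below K (k + 1), leftVec w α β (k + 1) (.num i j) * c i j =
      ∑ i ∈ below K k, ∑ j ∈ below K k, leftVec w α β k (.num i j) *
        (c i j * (1 : Matrix (Fin 2) (Fin 2) ℝ) (α k) (β k)) +
      ∑ i ∈ below K k, leftVec w α β k (.cre i) * (c i k * matA (α k) (β k)) +
      (∑ j ∈ below K k, leftVec w α β k (.ann j) * (c k j * matA.transpose (α k) (β k)) +
      leftVec w α β k .one * (c k k * (matA.transpose * matA) (α k) (β k))) := by
  simp only [sum_below_succ]
  rw [← sum_add_distrib]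
  congr 1
  · refine sum_congr rfl fun i hi => congrArg₂ _ (sum_congr rfl fun j hj => ?_) ?_
    · rw [leftVec_num w α β k (mem_below.1 hi) (mem_below.1 hj)]; ring
    · rw [leftVec_num_right w α β k (mem_below.1 hi)]; ring
  · refine congrArg₂ _ (sum_congr rfl fun j hj => ?_) ?_
    · rw [leftVec_num_left w α β k (mem_below.1 hj)]; ring
    · rw [leftVec_num_self]; ring

theorem sum_leftVec_cre₂_succ (c : Fin K → Fin K → ℝ) :
    ∑ j ∈ below K (k + 1), ∑ i ∈ below K j, leftVec w α β (k + 1) (.cre₂ i j) * c i j =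
      ∑ j ∈ below K k, ∑ i ∈ below K j, leftVec w α β k (.cre₂ i j) *
        (c i j * (1 : Matrix (Fin 2) (Fin 2) ℝ) (α k) (β k)) +
      ∑ i ∈ below K k, leftVec w α β k (.cre i) * (c i k * matA.transpose (α k) (β k)) := by
  rw [sum_below_succ]
  refine congrArg₂ _ (sum_congr rfl fun j hj => sum_congr rfl fun i hi => ?_)
    (sum_congr rfl fun i hi => ?_)
  · rw [leftVec_cre₂ w α β k ((mem_below.1 hi).trans (mem_below.1 hj)) (mem_below.1 hj)]; ring
  · rw [leftVec_cre₂_right w α β k (mem_below.1 hi)]; ring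

theorem sum_leftVec_ann₂_succ (c : Fin K → Fin K → ℝ) :
    ∑ j ∈ below K (k + 1), ∑ i ∈ below K j, leftVec w α β (k + 1) (.ann₂ i j) * c i j =
      ∑ j ∈ below K k, ∑ i ∈ below K j, leftVec w α β k (.ann₂ i j) *
        (c i j * (1 : Matrix (Fin 2) (Fin 2) ℝ) (α k) (β k)) +
      ∑ i ∈ below K k, leftVec w α β k (.ann i) * (c i k * matA (α k) (β k)) := by
  rw [sum_below_succ]
  refine congrArg₂ _ (sum_congr rfl fun j hj => sum_congr rfl fun i hi => ?_)
    (sum_congr rfl fun i hi => ?_)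
  · rw [leftVec_ann₂ w α β k ((mem_below.1 hi).trans (mem_below.1 hj)) (mem_below.1 hj)]; ring
  · rw [leftVec_ann₂_right w α β k (mem_below.1 hi)]; ring

/-- The recursions of `leftVec` hold at every site, so each column of `rightCore` is one of them
read through the relabelling in `rightVec`. Wherever a row `e`, `eStar` or `full` is needed, the
column label already forces `k + 2 ≤ K`, so that row is present. -/
theorem rightVec_succ (l' : Label K) (hl' : IsRight (k + 1) l') :
    rightVec w α β (k + 1) l' =
      ∑ l : {l : Label K // IsRight k.val l},
        rightVec w α β k l.1 * rightCore w k l.1 l' (α k) (β k) := by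
  rw [sum_isRight k fun l => rightVec w α β k l * rightCore w k l l' (α k) (β k)]
  cases l' with
  | one =>
    simp [rightCore, rightVec, leftVec_full, ite_entry, sum_pair_ite_right,
      -Matrix.transpose_apply, sum_mul]
    simp only [mul_assoc]
    ring
  | cre i =>
    simp only [IsRight] at hl'
    have h1 : k.val + 2 ≤ K := by omega
    have h2 : k.val ≤ i := by omega
    simp [rightCore, rightVec, leftVec_eStar, ite_entry, sum_pair_ite_right,
      -Matrix.transpose_apply, sum_mul, h1, h2, hl']
    simp only [mul_assoc]
  | ann i =>
    simp only [IsRight] at hl'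
    have h1 : k.val + 2 ≤ K := by omega
    have h2 : k.val ≤ i := by omega
    simp [rightCore, rightVec, leftVec_e, ite_entry, sum_pair_ite_right, -Matrix.transpose_apply,
      sum_mul, h1, h2, hl']
    simp only [mul_assoc]
  | num i j =>
    simp only [IsRight] at hl'
    have h1 : k.val + 2 ≤ K := by omega
    have h2 : k.val ≤ i := by omega
    have h3 : k.val ≤ j := by omega
    simp [rightCore, rightVec, sum_leftVec_num_succ, ite_entry, sum_pair_ite_right,
      -Matrix.transpose_apply, sum_mul, h1, h2, h3]
    simp only [mul_assoc]
    ring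
  | cre₂ i j =>
    simp only [IsRight] at hl'
    have h1 : k.val + 2 ≤ K := by omega
    have h2 : k.val ≤ i := by omega
    have h3 : k.val ≤ j := by omega
    simp [rightCore, rightVec, sum_leftVec_ann₂_succ, ite_entry, sum_pair_ite_right,
      -Matrix.transpose_apply, sum_mul, h1, h2, hl']
    simp only [mul_assoc]
  | ann₂ i j =>
    simp only [IsRight] at hl'
    have h1 : k.val + 2 ≤ K := by omega
    have h2 : k.val ≤ i := by omega
    have h3 : k.val ≤ j := by omega
    simp [rightCore, rightVec, sum_leftVec_cre₂_succ, ite_entry, sum_pair_ite_right,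
      -Matrix.transpose_apply, sum_mul, h1, h2, hl']
    simp only [mul_assoc]
  | e j =>
    simp only [IsRight] at hl'
    have h1 : k.val + 2 ≤ K := by omega
    rcases eq_or_ne j k with rfl | h
    · simp [rightCore, rightVec, leftVec_ann_self, ite_entry, h1, -Matrix.transpose_apply]
    · have hi : j.val < k := by omega
      simp [rightCore, rightVec, leftVec_ann, ite_entry, hi, h, h1]
  | eStar j =>
    simp only [IsRight] at hl'
    have h1 : k.val + 2 ≤ K := by omega
    rcases eq_or_ne j k with rfl | h
    · simp [rightCore, rightVec, leftVec_cre_self, ite_entry, h1, -Matrix.transpose_apply]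
    · have hi : j.val < k := by omega
      simp [rightCore, rightVec, leftVec_cre, ite_entry, hi, h, h1]
  | full =>
    simp only [IsRight] at hl'
    have h1 : k.val + 2 ≤ K := by omega
    simp [rightCore, rightVec, leftVec_one, h1]

end LeftHalf

/-! ### Anticommutation and the ordered form of the two-particle operator -/

section Strings

variable {K : ℕ}

/-- An occupation-number configuration, continued by `0`. -/
def extend (α : Fin K → Fin 2) (n : ℕ) : Fin 2 := if h : n < K then α ⟨n, h⟩ else 0

@[simp] theorem extend_val (α : Fin K → Fin 2) (k : Fin K) : extend α k = α k := by
  simp [extend]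

theorem kron_mul (M N : Fin K → Matrix (Fin 2) (Fin 2) ℝ) :
    kron M * kron N = kron fun k => M k * N k := by
  ext α β
  simp only [kron, Matrix.mul_apply, ← prod_mul_distrib]
  rw [prod_univ_sum]
  simp

theorem kron_transpose (M : Fin K → Matrix (Fin 2) (Fin 2) ℝ) :
    (kron M).transpose = kron fun k => (M k).transpose := rfl

theorem annihilation_eq (i : Fin K) : annihilation i = kron fun k => siteOp i k := by
  simp [annihilation, siteOp, Fin.lt_def, Fin.ext_iff, -Fin.val_fin_lt]

theorem string_apply (i₁ i₂ j₁ j₂ : Fin K) (α β : Fin K → Fin 2) :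
    (creation i₁ * creation i₂ * annihilation j₁ * annihilation j₂) α β =
      stringPrefix (extend α) (extend β) K i₁ i₂ j₁ j₂ := by
  simp only [creation, annihilation_eq, kron_transpose, kron_mul]
  rw [stringPrefix, ← Fin.prod_univ_eq_prod_range]
  simp [kron, stringSite]

theorem annihilation_mul_self (i : Fin K) : annihilation i * annihilation i = 0 := by
  rw [annihilation_eq, kron_mul]
  ext α β
  refine prod_eq_zero (mem_univ i) ?_
  have : matA * matA = 0 := by
    ext i j; fin_cases i <;> fin_cases j <;> simp [matA, Matrix.mul_apply]
  simp [siteOp_self, this]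

/-- The two products differ only at site `i`, where `A S = -A` faces `S A = A`. Before it both
factors are `S`, and after it the factor of `a_i` is the identity. -/
theorem annihilation_mul_of_lt {i j : Fin K} (h : i < j) :
    annihilation i * annihilation j = -(annihilation j * annihilation i) := by
  rw [annihilation_eq, annihilation_eq, kron_mul, kron_mul]
  ext α β
  simp only [kron, Matrix.neg_apply]
  rw [← mul_prod_erase _ _ (mem_univ i),
    ← mul_prod_erase univ (fun k : Fin K => (siteOp j k * siteOp i k) (α k) (β k)) (mem_univ i),
    ← neg_mul]
  congr 1
  · simp [siteOp_self, siteOp_of_lt (Fin.lt_def.1 h), matA_mul_matS, matS_mul_matA]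
  · refine prod_congr rfl fun k hk => ?_
    have hk : k.val ≠ i := fun h => (mem_erase.1 hk).1 (Fin.ext h)
    rcases lt_or_gt_of_ne hk with h' | h'
    · rw [siteOp_of_lt h', siteOp_of_lt (h'.trans h)]
    · rw [siteOp_of_gt h', one_mul, mul_one]

theorem annihilation_mul_comm (i j : Fin K) :
    annihilation i * annihilation j = -(annihilation j * annihilation i) := by
  rcases lt_trichotomy i j with h | rfl | h
  · exact annihilation_mul_of_lt h
  · simp [annihilation_mul_self]
  · rw [annihilation_mul_of_lt h, neg_neg]

theorem creation_mul_comm (i j : Fin K) :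
    creation i * creation j = -(creation j * creation i) := by
  simp only [creation, ← Matrix.transpose_mul]
  rw [annihilation_mul_comm, Matrix.transpose_neg]

theorem sum_antisymm (c G : Fin K → Fin K → ℝ) (hG : ∀ i j, G i j = -G j i) :
    ∑ i, ∑ j, c i j * G i j = ∑ j : Fin K, ∑ i ∈ below K j, (c i j - c j i) * G i j := by
  have h1 : ∀ g : Fin K → Fin K → ℝ, ∑ j : Fin K, ∑ i ∈ below K j, g i j =
      ∑ j, ∑ i, if i < j then g i j else 0 := by
    intro g; simp [below, sum_filter]
  have h2 : ∑ j : Fin K, ∑ i, (if i < j then c j i * G i j else 0) =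
      ∑ j : Fin K, ∑ i, (if j < i then c i j * G j i else 0) := sum_comm
  simp only [sub_mul, sum_sub_distrib]
  rw [h1, h1, h2, sum_comm, ← sum_sub_distrib]
  refine sum_congr rfl fun j _ => ?_
  rw [← sum_sub_distrib]
  refine sum_congr rfl fun i _ => ?_
  rcases lt_trichotomy i j with h | rfl | h
  · simp [h, h.not_gt]
  · have : G i i = 0 := by linarith [hG i i]
    simp [this]
  · simp [h, h.not_gt, hG i j]

/-- `sum_antisymm` is applied once to the annihilators and once to the creators; the two
antisymmetrizations of `v` combine to `vTilde`. -/
theorem twoParticle_apply (v : Fin K → Fin K → Fin K → Fin K → ℝ) (α β : Fin K → Fin 2) :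
    twoParticle v α β = ∑ i₂ : Fin K, ∑ i₁ ∈ below K i₂, ∑ j₂ : Fin K, ∑ j₁ ∈ below K j₂,
      vTilde v i₁ i₂ j₁ j₂ * stringPrefix (extend α) (extend β) K i₁ i₂ j₁ j₂ := by
  have hi : ∀ i₁ i₂ j₁ j₂ : Fin K, stringPrefix (extend α) (extend β) K i₁ i₂ j₁ j₂ =
      -stringPrefix (extend α) (extend β) K i₂ i₁ j₁ j₂ := by
    intro i₁ i₂ j₁ j₂
    rw [← string_apply, ← string_apply, creation_mul_comm i₁ i₂]
    simp
  have hj : ∀ i₁ i₂ j₁ j₂ : Fin K, stringPrefix (extend α) (extend β) K i₁ i₂ j₁ j₂ =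
      -stringPrefix (extend α) (extend β) K i₁ i₂ j₂ j₁ := by
    intro i₁ i₂ j₁ j₂
    rw [← string_apply, ← string_apply, Matrix.mul_assoc, annihilation_mul_comm j₁ j₂,
      Matrix.mul_assoc _ (annihilation j₂)]
    simp
  have h1 : ∀ i₁ i₂ : Fin K, ∑ j₁, ∑ j₂,
      v i₁ i₂ j₁ j₂ * stringPrefix (extend α) (extend β) K i₁ i₂ j₁ j₂ =
      ∑ j₂ : Fin K, ∑ j₁ ∈ below K j₂, (v i₁ i₂ j₁ j₂ - v i₁ i₂ j₂ j₁) *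
        stringPrefix (extend α) (extend β) K i₁ i₂ j₁ j₂ := fun i₁ i₂ =>
    sum_antisymm (fun j₁ j₂ => v i₁ i₂ j₁ j₂)
      (fun j₁ j₂ : Fin K => stringPrefix (extend α) (extend β) K i₁ i₂ j₁ j₂) (hj i₁ i₂)
  have h2 := fun (j₁ j₂ : Fin K) => sum_antisymm (fun i₁ i₂ => v i₁ i₂ j₁ j₂ - v i₁ i₂ j₂ j₁)
      (fun i₁ i₂ : Fin K => stringPrefix (extend α) (extend β) K i₁ i₂ j₁ j₂)
      fun i₁ i₂ => hi i₁ i₂ j₁ j₂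
  simp only [twoParticle, Matrix.sum_apply, Matrix.smul_apply, string_apply, smul_eq_mul, h1]
  have swap : ∀ f : Fin K → Fin K → Fin K → Fin K → ℝ,
      ∑ i₁, ∑ i₂, ∑ j₂ : Fin K, ∑ j₁ ∈ below K j₂, f i₁ i₂ j₁ j₂ =
      ∑ j₂ : Fin K, ∑ j₁ ∈ below K j₂, ∑ i₁, ∑ i₂, f i₁ i₂ j₁ j₂ := by
    intro f
    rw [sum_congr rfl fun i₁ _ => sum_comm, sum_comm]
    refine sum_congr rfl fun j₂ _ => ?_
    rw [sum_congr rfl fun i₁ _ => sum_comm, sum_comm]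
  rw [swap]
  simp only [h2]
  have swap' : ∀ f : Fin K → Fin K → Fin K → Fin K → ℝ,
      ∑ j₂ : Fin K, ∑ j₁ ∈ below K j₂, ∑ i₂ : Fin K, ∑ i₁ ∈ below K i₂, f i₁ i₂ j₁ j₂ =
      ∑ i₂ : Fin K, ∑ i₁ ∈ below K i₂, ∑ j₂ : Fin K, ∑ j₁ ∈ below K j₂, f i₁ i₂ j₁ j₂ := by
    intro f
    rw [sum_congr rfl fun i₁ _ => sum_comm, sum_comm]
    refine sum_congr rfl fun j₂ _ => ?_
    rw [sum_congr rfl fun i₁ _ => sum_comm, sum_comm]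
  rw [swap']
  refine sum_congr rfl fun i₂ _ => sum_congr rfl fun i₁ h₁ => sum_congr rfl fun j₂ _ =>
    sum_congr rfl fun j₁ h₂ => ?_
  rw [mem_below] at h₁ h₂
  rw [vTilde, if_pos ⟨h₁, h₂⟩]
  ring

end Strings

/-! ### The explicit operator represents `twoParticle v` -/

section Explicit

variable {K : ℕ}

theorem sum_subtype_congr {M : Type*} [AddCommMonoid M] {p q : Label K → Prop} [DecidablePred p]
    [DecidablePred q] (h : ∀ l, p l ↔ q l) (f : Label K → M) :
    ∑ l : {l // p l}, f l.1 = ∑ l : {l // q l}, f l.1 :=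
  Fintype.sum_equiv (Equiv.subtypeEquivRight h) _ _ fun _ => rfl

theorem rightVec_last (w : Fin K → Fin K → Fin K → Fin K → ℝ) (α β : ℕ → Fin 2) :
    rightVec w α β K .one = ∑ i₂ : Fin K, ∑ i₁ ∈ below K i₂, ∑ j₂ : Fin K, ∑ j₁ ∈ below K j₂,
      w i₁ i₂ j₁ j₂ * -stringPrefix α β K i₁ i₂ j₁ j₂ := by
  have : below K K = univ := by ext i; simp
  simp [rightVec, leftVec, this]

theorem explicitMPO_toMatrix (hK : 2 ≤ K) (v : Fin K → Fin K → Fin K → Fin K → ℝ) :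
    (explicitMPO hK v).toMatrix = twoParticle v := by
  ext α β
  set w : Fin K → Fin K → Fin K → Fin K → ℝ := fun a b c d => -vTilde v a b c d with hw
  have hK2 : 0 < K / 2 := by omega
  have hKK : ¬ K < K / 2 := by omega
  -- The guess changes from `leftVec` to `rightVec` at the cut `K / 2`, whose bond is already of
  -- right type because the middle matrix is absorbed into the preceding core.
  let vec (s : ℕ) (l : Label K) : ℝ :=
    if s < K / 2 then leftVec w (extend α) (extend β) s l else rightVec w (extend α) (extend β) s l
  have step : ∀ (k : Fin K) (l' : {l : Label K // IsBond K (k + 1) l}), vec (k + 1) l'.1 =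
      ∑ l : {l : Label K // IsBond K k l}, vec k l.1 *
        ((if k.val + 1 < K / 2 then leftCore w k l.1 l'.1
          else if k.val + 1 = K / 2 then
            ∑ m : {m : Label K // IsLeft (K / 2) m}, midMatrix w m.1 l'.1 • leftCore w k l.1 m.1
          else rightCore w k l.1 l'.1) : Matrix (Fin 2) (Fin 2) ℝ) (α k) (β k) := by
    rintro k ⟨l', hl'⟩
    simp only [vec]
    rcases lt_trichotomy (k.val + 1) (K / 2) with h | h | h
    · have h' : k.val < K / 2 := by omega
      simp only [IsBond, h, if_true] at hl'
      simp only [h, h', if_true]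
      rw [leftVec_succ w _ _ k l' hl', extend_val, extend_val]
      exact (sum_subtype_congr (fun l => by simp only [IsBond, h', if_true])
        fun l => leftVec w (extend α) (extend β) k l * leftCore w k l l' (α k) (β k)).symm
    · have h' : k.val < K / 2 := by omega
      simp only [IsBond, h, lt_irrefl, if_false] at hl'
      simp only [h, h', lt_irrefl, if_true, if_false]
      rw [← sum_leftVec_mul_midMatrix w _ _ _ l' hl',
        sum_subtype_congr (q := IsLeft k.val) (fun l => by simp only [IsBond, h', if_true])
          fun l => leftVec w (extend α) (extend β) k l *
            (∑ m : {m : Label K // IsLeft (K / 2) m}, midMatrix w m.1 l' • leftCore w k l m.1)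
              (α k) (β k)]
      simp only [Matrix.sum_apply, Matrix.smul_apply, smul_eq_mul, mul_sum]
      -- With the sum over the absorbed index `m` outermost, the inner sum is one left step to the
      -- cut `K / 2`.
      rw [sum_comm]
      refine sum_congr rfl fun m _ => ?_
      obtain ⟨m, hm⟩ := m
      have hm' := hm
      simp only [← h] at hm' ⊢
      rw [leftVec_succ w _ _ k m hm', sum_mul, extend_val, extend_val]
      exact sum_congr rfl fun l _ => by ring
    · have h' : ¬ k.val < K / 2 := by omega
      have h1 : ¬ k.val + 1 < K / 2 := by omega
      simp only [IsBond, h1, if_false] at hl'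
      simp only [h1, h', h.ne', if_false]
      rw [rightVec_succ w _ _ k l' hl', extend_val, extend_val]
      exact (sum_subtype_congr (fun l => by simp only [IsBond, h', if_false])
        fun l => rightVec w (extend α) (extend β) k l * rightCore w k l l' (α k) (β k)).symm
  have first : ∀ l : {l : Label K // IsBond K 0 l}, vec 0 l.1 = 1 := by
    rintro ⟨l, hl⟩
    simp only [IsBond, hK2, if_true] at hl
    simp only [vec, hK2, if_true]
    cases l <;> simp [IsLeft] at hl
    simp [leftVec, stringPrefix]
  rw [(explicitMPO hK v).toMatrix_eq_of_propagate α β (fun k l => vec k l.1) first step]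
  have last : ∀ l : {l : Label K // IsBond K K l}, vec K l.1 = twoParticle v α β := by
    rintro ⟨l, hl⟩
    simp only [IsBond, hKK, if_false] at hl
    simp only [vec, hKK, if_false]
    have : l = .one := by cases l <;> simp only [IsRight] at hl <;> first | rfl | omega
    rw [this, rightVec_last, twoParticle_apply]
    simp [hw]
  obtain ⟨x, hx⟩ := Fintype.card_eq_one_iff.1 (explicitMPO hK v).card_last
  rw [Fintype.sum_eq_single x fun y hy => absurd (hx y) hy]
  exact last x

end Explicit

/-! ### From ranks of unfoldings to a matrix product operator -/

section TensorTrain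

variable {K : ℕ}

/-- The configuration that agrees with `γ` in front of the cut `s` and with `η` behind it. -/
def glue {σ : Type*} (s : ℕ) (γ η : Fin K → σ) : Fin K → σ :=
  fun k => if k.val < s then γ k else η k

theorem glue_zero {σ : Type*} (γ η : Fin K → σ) : glue 0 γ η = η := by ext k; simp [glue]

theorem glue_last {σ : Type*} (γ η : Fin K → σ) : glue K γ η = γ := by ext k; simp [glue]

/-- `T` is a sum of `r` products of a function of the sites `< s` and a function of the sites
`≥ s`. -/
def CutRankLE {σ : Type} (T : (Fin K → σ) → ℝ) (s r : ℕ) : Prop :=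
  ∃ (ι : Type) (_ : Fintype ι) (L R : ι → (Fin K → σ) → ℝ), Fintype.card ι ≤ r ∧
    ∀ γ η, T (glue s γ η) = ∑ i, L i γ * R i η

/-- The span of the functions of the sites `< s` that arise by freezing the others in `T`. -/
def cutSpan {σ : Type} (T : (Fin K → σ) → ℝ) (s : ℕ) : Submodule ℝ ((Fin K → σ) → ℝ) :=
  Submodule.span ℝ (Set.range fun η γ => T (glue s γ η))

theorem finrank_cutSpan_le {σ : Type} {T : (Fin K → σ) → ℝ} {s r : ℕ} (h : CutRankLE T s r) :
    Module.finrank ℝ (cutSpan T s) ≤ r := by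
  obtain ⟨ι, _, L, R, hr, h⟩ := h
  have hle : cutSpan T s ≤ Submodule.span ℝ (Set.range L) := by
    refine Submodule.span_le.2 ?_
    rintro _ ⟨η, rfl⟩
    have : (fun γ => T (glue s γ η)) = ∑ i, R i η • L i := by
      ext γ; simp [h, mul_comm]
    beta_reduce
    rw [this]
    exact Submodule.sum_mem _ fun i _ => Submodule.smul_mem _ _ (Submodule.subset_span ⟨i, rfl⟩)
  have : FiniteDimensional ℝ (Submodule.span ℝ (Set.range L)) :=
    FiniteDimensional.span_of_finite ℝ (Set.finite_range L)
  exact (Submodule.finrank_mono hle).trans ((finrank_range_le_card L).trans hr)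

/-- Freezing site `k` can be charged to the other side of the cut: gluing `update γ k x` and `η` at
`k + 1` equals gluing `γ` and `update η k x` at `k`. This nestedness of the spans is what makes the
cores exist. -/
theorem comp_update_mem_cutSpan {σ : Type} (T : (Fin K → σ) → ℝ) (k : Fin K) (x : σ)
    {f : (Fin K → σ) → ℝ} (hf : f ∈ cutSpan T (k + 1)) :
    (fun γ => f (Function.update γ k x)) ∈ cutSpan T k := by
  have hle : cutSpan T (k + 1) ≤
      (cutSpan T k).comap (LinearMap.funLeft ℝ ℝ fun γ => Function.update γ k x) := by
    refine Submodule.span_le.2 ?_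
    rintro _ ⟨η, rfl⟩
    refine Submodule.subset_span ⟨Function.update η k x, ?_⟩
    ext γ
    simp only [LinearMap.funLeft_apply]
    congr 1
    ext j
    simp only [glue, Function.update_apply]
    rcases lt_trichotomy j.val k.val with h | h | h
    · simp [h, h.trans (Nat.lt_succ_self _), Fin.ext_iff, h.ne]
    · simp [h, Fin.ext_iff]
    · have : ¬ j.val < k + 1 := by omega
      simp [h.not_gt, this, Fin.ext_iff, h.ne']
  exact hle hf

/-- Bounded ranks of all unfoldings yield a matrix product operator with these ranks. -/
theorem exists_mpo_of_cutRankLE (hK : 0 < K) (D : Matrix (Fin K → Fin 2) (Fin K → Fin 2) ℝ)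
    (r : ℕ) (hr : 1 ≤ r)
    (h : ∀ s ≤ K, CutRankLE
        (fun γ : Fin K → Fin 2 × Fin 2 => D (fun k => (γ k).1) fun k => (γ k).2) s r) :
    ∃ M : MPO K, M.toMatrix = D ∧ ∀ k, M.rank k ≤ r := by
  set T : (Fin K → Fin 2 × Fin 2) → ℝ := fun γ => D (fun k => (γ k).1) fun k => (γ k).2 with hT
  -- Inner cuts use a basis of `cutSpan T s`. The end cuts are set by hand to the constant 1 and to
  -- `T`, so that their bonds are singletons even when `T = 0`; this is why `1 ≤ r` is assumed and
  -- why membership in the span is not asked at `s = 0`.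
  have fam : ∀ s : Fin (K + 1), ∃ (n : ℕ) (u : Fin n → (Fin K → Fin 2 × Fin 2) → ℝ), n ≤ r ∧
      cutSpan T s ≤ Submodule.span ℝ (Set.range u) ∧ (s ≠ 0 → ∀ l, u l ∈ cutSpan T s) ∧
      (s = 0 → n = 1 ∧ ∀ l, u l = 1) ∧ (s = Fin.last K → n = 1 ∧ ∀ l, u l = T) := by
    intro s
    have h0 : (0 : Fin (K + 1)) ≠ Fin.last K := by
      simp [Fin.ext_iff, hK.ne]
    by_cases hs0 : s = 0
    · subst hs0
      refine ⟨1, fun _ => 1, hr, Submodule.span_le.2 ?_, fun h => absurd rfl h,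
        fun _ => ⟨rfl, fun _ => rfl⟩, fun h => absurd h h0⟩
      rintro _ ⟨η, rfl⟩
      have : (fun γ => T (glue ((0 : Fin (K + 1)) : ℕ) γ η)) =
          T η • (1 : (Fin K → Fin 2 × Fin 2) → ℝ) := by
        ext γ; simp [glue_zero]
      beta_reduce
      rw [this]
      exact Submodule.smul_mem _ _ (Submodule.subset_span ⟨0, rfl⟩)
    · by_cases hs1 : s = Fin.last K
      · subst hs1
        have hg : ∀ η : Fin K → Fin 2 × Fin 2, (fun γ => T (glue (Fin.last K : ℕ) γ η)) = T := by
          intro η; ext γ; simp [glue_last]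
        refine ⟨1, fun _ => T, hr, Submodule.span_le.2 ?_, fun _ _ => Submodule.subset_span
          ⟨0, hg 0⟩, fun h => absurd h hs0, fun _ => ⟨rfl, fun _ => rfl⟩⟩
        rintro _ ⟨η, rfl⟩
        simp only [hg]
        exact Submodule.subset_span ⟨0, rfl⟩
      · let b := Module.finBasis ℝ (cutSpan T s)
        refine ⟨_, fun l => (b l : (Fin K → Fin 2 × Fin 2) → ℝ),
          finrank_cutSpan_le (h s (Nat.lt_succ_iff.1 s.2)), ?_, fun _ l => (b l).2,
          fun h => absurd h hs0, fun h => absurd h hs1⟩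
        have := congrArg (Submodule.map (cutSpan T s).subtype) b.span_eq
        rw [Submodule.map_span, Submodule.map_top, Submodule.range_subtype,
          ← Set.range_comp] at this
        exact this.symm.le
  choose n u hn hspan hmem hfirst hlast using fam
  -- The cores are the coefficients of the functions at cut `k + 1`, with site `k` frozen, in terms
  -- of those at cut `k`. The functions themselves are then the propagated row vectors.
  have core : ∀ (k : Fin K) (x : Fin 2 × Fin 2) (l' : Fin (n k.succ)), ∃ c : Fin (n k.castSucc) → ℝ,
      ∑ l, c l • u k.castSucc l = fun γ => u k.succ l' (Function.update γ k x) := by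
    intro k x l'
    exact (Submodule.mem_span_range_iff_exists_fun ℝ).1 (hspan k.castSucc
      (comp_update_mem_cutSpan T k x (hmem k.succ (Fin.succ_ne_zero k) l')))
  choose c hc using core
  refine ⟨{
    bond := fun k => Fin (n k)
    fin := fun _ => inferInstance
    card_first := by rw [Fintype.card_fin]; exact (hfirst 0 rfl).1
    card_last := by rw [Fintype.card_fin]; exact (hlast _ rfl).1
    core := fun k l l' a b => c k (a, b) l' l }, ?_, fun k => ?_⟩
  · ext α β
    rw [MPO.toMatrix_eq_of_propagate _ α β (fun k l => u k l fun i => (α i, β i))]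
    · obtain ⟨h1, h2⟩ := hlast (Fin.last K) rfl
      refine (sum_congr rfl fun l _ => congrFun (h2 l) _).trans ?_
      rw [sum_const, card_univ]
      change Fintype.card (Fin (n (Fin.last K))) • _ = _
      rw [Fintype.card_fin, h1, one_smul]
    · intro l
      exact congrFun ((hfirst 0 rfl).2 l) _
    · intro k l'
      have := congrFun (hc k (α k, β k) l') fun i => (α i, β i)
      have hup : Function.update (fun i => (α i, β i)) k (α k, β k) = fun i => (α i, β i) :=
        Function.update_eq_self k _
      rw [hup] at this
      rw [← this, Finset.sum_apply]
      exact sum_congr rfl fun l _ => mul_comm _ _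
  · change Fintype.card (Fin (n k)) ≤ r
    rw [Fintype.card_fin]
    exact hn k

end TensorTrain

/-! ### Operators of finite range -/

section FiniteRange

variable {K : ℕ}

/-- A sum of products, sorted by labels that determine one of the two factors. -/
theorem cutRankLE_of_labels {Θ Λ : Type} {σ : Type} [Fintype Λ] [DecidableEq Λ]
    (p : Λ → Prop) [DecidablePred p] (left : Λ → Prop) (s : ℕ) (T : (Fin K → σ) → ℝ) (𝒯 : Finset Θ)
    (f : Θ → Λ) (c : Θ → ℝ) (Q R : Θ → (Fin K → σ) → ℝ) (Lf Rf : Λ → (Fin K → σ) → ℝ)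
    (hT : ∀ γ η, T (glue s γ η) = ∑ t ∈ 𝒯, c t * (Q t γ * R t η)) (hp : ∀ t ∈ 𝒯, p (f t))
    (hQ : ∀ t ∈ 𝒯, left (f t) → Q t = Lf (f t)) (hR : ∀ t ∈ 𝒯, ¬ left (f t) → R t = Rf (f t)) :
    CutRankLE T s (Fintype.card {l // p l}) := by
  classical
  refine ⟨{l // p l}, inferInstance,
    fun l γ => if left l then Lf l γ else ∑ t ∈ 𝒯 with f t = l, c t * Q t γ,
    fun l η => if left l then ∑ t ∈ 𝒯 with f t = l, c t * R t η else Rf l η, le_rfl, fun γ η => ?_⟩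
  -- All terms with label `l` share one factor, on the left or on the right, so together they form a
  -- single product.
  have h1 : ∀ l, (if left l then Lf l γ else ∑ t ∈ 𝒯 with f t = l, c t * Q t γ) *
      (if left l then ∑ t ∈ 𝒯 with f t = l, c t * R t η else Rf l η) =
      ∑ t ∈ 𝒯 with f t = l, c t * (Q t γ * R t η) := by
    intro l
    split_ifs with h
    · rw [mul_sum]
      refine sum_congr rfl fun t ht => ?_
      obtain ⟨ht', rfl⟩ := mem_filter.1 ht
      rw [hQ t ht' h]; ring
    · rw [sum_mul]
      refine sum_congr rfl fun t ht => ?_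
      obtain ⟨ht', rfl⟩ := mem_filter.1 ht
      rw [hR t ht' h]; ring
  simp only [h1]
  rw [hT, ← Finset.sum_subtype (univ.filter p) (by simp)
    fun l => ∑ t ∈ 𝒯 with f t = l, c t * (Q t γ * R t η)]
  exact (sum_fiberwise_of_maps_to (fun t ht => by simp [hp t ht]) _).symm

/-- The part of an entry of `a_{i₁}* a_{i₂}* a_{j₁} a_{j₂}` contributed by the sites `≥ s`. -/
def stringSuffix (K : ℕ) (α β : ℕ → Fin 2) (s i₁ i₂ j₁ j₂ : ℕ) : ℝ :=
  ∏ k ∈ Finset.Ico s K, stringSite i₁ i₂ j₁ j₂ k (α k) (β k)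

theorem stringPrefix_mul_stringSuffix (α β : ℕ → Fin 2) {s : ℕ} (hs : s ≤ K) (i₁ i₂ j₁ j₂ : ℕ) :
    stringPrefix α β K i₁ i₂ j₁ j₂ =
      stringPrefix α β s i₁ i₂ j₁ j₂ * stringSuffix K α β s i₁ i₂ j₁ j₂ :=
  (prod_range_mul_prod_Ico _ hs).symm

/-- The sites behind a cut do not distinguish orbitals in front of it. -/
theorem stringSuffix_congr (α β : ℕ → Fin 2) {s a b c d a' b' c' d' : ℕ}
    (ha : a = a' ∨ a < s ∧ a' < s) (hb : b = b' ∨ b < s ∧ b' < s) (hc : c = c' ∨ c < s ∧ c' < s)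
    (hd : d = d' ∨ d < s ∧ d' < s) :
    stringSuffix K α β s a b c d = stringSuffix K α β s a' b' c' d' := by
  have key : ∀ {x x' k : ℕ}, (x = x' ∨ x < s ∧ x' < s) → s ≤ k → siteOp x k = siteOp x' k := by
    rintro x x' k (rfl | ⟨h, h'⟩) hk
    · rfl
    · rw [siteOp_of_gt (by omega), siteOp_of_gt (by omega)]
  refine prod_congr rfl fun k hk => ?_
  have hk := (Finset.mem_Ico.1 hk).1
  simp only [stringSite, key ha hk, key hb hk, key hc hk, key hd hk]

/-- The label of a string at the cut `s`. Strings with two operators on either side carry the pair on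
the left if it lies within distance `P` of the cut, and the pair on the right otherwise. -/
def cutLabel (s P : ℕ) (t : Fin K × Fin K × Fin K × Fin K) : Label K :=
  if s ≤ t.1.val then
    if s ≤ t.2.2.1.val then .one
    else if s ≤ t.2.2.2.val then .ann t.2.2.1
    else if s ≤ t.2.2.1.val + P then .ann₂ t.2.2.1 t.2.2.2
    else .cre₂ t.1 t.2.1
  else if s ≤ t.2.1.val then
    if s ≤ t.2.2.1.val then .cre t.1
    else if s ≤ t.2.2.2.val then
      if s ≤ t.1.val + P ∧ s ≤ t.2.2.1.val + P then .num t.1 t.2.2.1 else .num t.2.1 t.2.2.2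
    else .eStar t.2.1
  else if s ≤ t.2.2.1.val then
    if s ≤ t.1.val + P then .cre₂ t.1 t.2.1 else .ann₂ t.2.2.1 t.2.2.2
  else if s ≤ t.2.2.2.val then .e t.2.2.2
  else .full

/-- Whether a label of `cutLabel` names operators on the left of the cut. -/
def NamesLeft (s : ℕ) : Label K → Prop
  | .one | .cre _ | .ann _ => True
  | .num i _ | .cre₂ i _ | .ann₂ i _ => i.val < s
  | .e _ | .eStar _ | .full => False

/-- The labels that occur at the cut `s` if all strings have range at most `d`. -/
def InRange (s d P Q : ℕ) : Label K → Prop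
  | .one | .full => True
  | .cre i | .ann i => s + 1 ≤ i.val + d ∧ i.val < s
  | .num i j => ((s ≤ i.val + P ∧ i.val < s) ∧ s ≤ j.val + P ∧ j.val < s) ∨
      (s ≤ i.val ∧ i.val < s + Q) ∧ s ≤ j.val ∧ j.val < s + Q
  | .cre₂ i j | .ann₂ i j => ((s ≤ i.val + P ∧ i.val < s) ∧ (s ≤ j.val + P ∧ j.val < s) ∧ i < j) ∨
      (s ≤ i.val ∧ i.val < s + Q) ∧ (s ≤ j.val ∧ j.val < s + Q) ∧ i < j
  | .e j | .eStar j => s ≤ j.val ∧ j.val + 1 < s + d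

/-- The common left factor of the strings with a given label. -/
def labelPrefix (α β : ℕ → Fin 2) (s : ℕ) : Label K → ℝ
  | .cre i => stringPrefix α β s i K K K
  | .ann j => stringPrefix α β s K K j K
  | .num i j => stringPrefix α β s i K j K
  | .cre₂ i j => stringPrefix α β s i j K K
  | .ann₂ i j => stringPrefix α β s K K i j
  | _ => stringPrefix α β s K K K K

/-- The common right factor of the strings with a given label. -/
def labelSuffix (α β : ℕ → Fin 2) (s : ℕ) : Label K → ℝ
  | .e j => stringSuffix K α β s 0 0 0 j
  | .eStar i => stringSuffix K α β s 0 i 0 0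
  | .num i j => stringSuffix K α β s 0 i 0 j
  | .cre₂ i j => stringSuffix K α β s i j 0 0
  | .ann₂ i j => stringSuffix K α β s 0 0 i j
  | _ => stringSuffix K α β s 0 0 0 0

theorem stringPrefix_eq_labelPrefix (α β : ℕ → Fin 2) {s P : ℕ} (hs : s ≤ K)
    (t : Fin K × Fin K × Fin K × Fin K) (hi : t.1 < t.2.1) (hj : t.2.2.1 < t.2.2.2)
    (hl : NamesLeft s (cutLabel s P t)) :
    stringPrefix α β s t.1 t.2.1 t.2.2.1 t.2.2.2 = labelPrefix α β s (cutLabel s P t) := by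
  revert hl
  unfold cutLabel
  split_ifs <;> simp only [NamesLeft, labelPrefix] <;> intro hl <;>
    first
    | exact hl.elim
    | omega
    | refine stringPrefix_congr α β ?_ ?_ ?_ ?_ <;> omega

/-- In `labelSuffix` the index `0` stands for an orbital in front of the cut. This is legitimate
because a string whose label does not name the left has an operator there, which forces `0 < s`. -/
theorem stringSuffix_eq_labelSuffix (α β : ℕ → Fin 2) {s P : ℕ}
    (t : Fin K × Fin K × Fin K × Fin K) (hi : t.1 < t.2.1) (hj : t.2.2.1 < t.2.2.2)
    (hl : ¬ NamesLeft s (cutLabel s P t)) :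
    stringSuffix K α β s t.1 t.2.1 t.2.2.1 t.2.2.2 = labelSuffix α β s (cutLabel s P t) := by
  revert hl
  unfold cutLabel
  split_ifs <;> simp only [NamesLeft, labelSuffix] <;> intro hl <;>
    first
    | exact (hl trivial).elim
    | omega
    | refine stringSuffix_congr α β ?_ ?_ ?_ ?_ <;> omega

/-- If the left pair is not within distance `P`, its smallest index is below `s - P`, so range `d =
P + Q` puts the right pair below `s + Q`. A lone operator on one side faces three on the other, two
of which are distinct of the same kind; one therefore lies a site further from the cut, leaving `d -
1` positions rather than `d`. -/
theorem inRange_cutLabel {s d P Q : ℕ} (hd : P + Q = d) (t : Fin K × Fin K × Fin K × Fin K)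
    (hi : t.1 < t.2.1) (hj : t.2.2.1 < t.2.2.2) (ht : spread t.1 t.2.1 t.2.2.1 t.2.2.2 ≤ d) :
    InRange s d P Q (cutLabel s P t) := by
  obtain ⟨i₁, i₂, j₁, j₂⟩ := t
  simp only [spread, max_le_iff, abs_le] at ht
  simp only at hi hj
  unfold cutLabel
  simp only
  split_ifs <;> simp only [InRange] <;> omega

theorem vTilde_eq_zero {d : ℕ} {v : Fin K → Fin K → Fin K → Fin K → ℝ}
    (hv : ∀ i₁ i₂ j₁ j₂ : Fin K, (d : ℤ) < spread i₁ i₂ j₁ j₂ → v i₁ i₂ j₁ j₂ = 0)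
    {i₁ i₂ j₁ j₂ : Fin K} (h : (d : ℤ) < spread i₁ i₂ j₁ j₂) : vTilde v i₁ i₂ j₁ j₂ = 0 := by
  have h1 : (d : ℤ) < spread i₂ i₁ j₁ j₂ := by
    simp only [spread, lt_max_iff, lt_abs] at h ⊢; omega
  have h2 : (d : ℤ) < spread i₁ i₂ j₂ j₁ := by
    simp only [spread, lt_max_iff, lt_abs] at h ⊢; omega
  have h3 : (d : ℤ) < spread i₂ i₁ j₂ j₁ := by
    simp only [spread, lt_max_iff, lt_abs] at h ⊢; omega
  simp [vTilde, hv _ _ _ _ h, hv _ _ _ _ h1, hv _ _ _ _ h2, hv _ _ _ _ h3]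

theorem twoParticle_apply_eq_sum_support (v : Fin K → Fin K → Fin K → Fin K → ℝ)
    (α β : Fin K → Fin 2) :
    twoParticle v α β =
      ∑ t : Fin K × Fin K × Fin K × Fin K with vTilde v t.1 t.2.1 t.2.2.1 t.2.2.2 ≠ 0,
      vTilde v t.1 t.2.1 t.2.2.1 t.2.2.2 *
        stringPrefix (extend α) (extend β) K t.1 t.2.1 t.2.2.1 t.2.2.2 := by
  have hz : ∀ i₁ i₂ j₁ j₂ : Fin K, ¬ (i₁ < i₂ ∧ j₁ < j₂) → vTilde v i₁ i₂ j₁ j₂ = 0 :=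
    fun _ _ _ _ h => if_neg h
  rw [sum_filter_of_ne fun t _ h => left_ne_zero_of_mul h, twoParticle_apply]
  simp only [Fintype.sum_prod_type]
  rw [sum_comm]
  refine sum_congr rfl fun i₂ _ => ?_
  refine sum_subset_zero_on_sdiff (subset_univ _) (fun i₁ h => ?_) fun i₁ _ => ?_
  · refine sum_eq_zero fun j₁ _ => sum_eq_zero fun j₂ _ => ?_
    rw [hz, zero_mul]
    simpa using fun h' => absurd h' (by simpa using h)
  · rw [sum_comm]
    refine sum_congr rfl fun j₂ _ => ?_
    refine sum_subset_zero_on_sdiff (subset_univ _) (fun j₁ h => ?_) fun j₁ _ => rfl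
    rw [hz, zero_mul]
    simpa using fun _ => (by simpa using h)

instance (s d P Q : ℕ) : DecidablePred (InRange (K := K) s d P Q) := fun l => by
  cases l <;> unfold InRange <;> infer_instance

/-- Restricting the sum to the support of `vTilde` makes every remaining string ordered and of range
at most `d`, as the labelling requires. -/
theorem cutRankLE_twoParticle {s d P Q : ℕ} (hs : s ≤ K) (hd : P + Q = d)
    {v : Fin K → Fin K → Fin K → Fin K → ℝ}
    (hv : ∀ i₁ i₂ j₁ j₂ : Fin K, (d : ℤ) < spread i₁ i₂ j₁ j₂ → v i₁ i₂ j₁ j₂ = 0) :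
    CutRankLE (fun γ : Fin K → Fin 2 × Fin 2 => twoParticle v (fun k => (γ k).1) fun k => (γ k).2) s
      (Fintype.card {l : Label K // InRange s d P Q l}) := by
  have supp : ∀ t ∈ (univ : Finset (Fin K × Fin K × Fin K × Fin K)).filter
      (fun t => vTilde v t.1 t.2.1 t.2.2.1 t.2.2.2 ≠ 0),
      t.1 < t.2.1 ∧ t.2.2.1 < t.2.2.2 ∧ spread t.1 t.2.1 t.2.2.1 t.2.2.2 ≤ d := by
    intro t ht
    have ht := (mem_filter.1 ht).2
    have h : t.1 < t.2.1 ∧ t.2.2.1 < t.2.2.2 := by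
      by_contra h
      exact ht (if_neg h)
    exact ⟨h.1, h.2, not_lt.1 fun h => ht (vTilde_eq_zero hv h)⟩
  let α (γ : Fin K → Fin 2 × Fin 2) : ℕ → Fin 2 := extend fun k => (γ k).1
  let β (γ : Fin K → Fin 2 × Fin 2) : ℕ → Fin 2 := extend fun k => (γ k).2
  refine cutRankLE_of_labels (InRange s d P Q) (NamesLeft s) s _
    (univ.filter fun t : Fin K × Fin K × Fin K × Fin K => vTilde v t.1 t.2.1 t.2.2.1 t.2.2.2 ≠ 0)
    (cutLabel s P) (fun t => vTilde v t.1 t.2.1 t.2.2.1 t.2.2.2)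
    (fun t γ => stringPrefix (α γ) (β γ) s t.1 t.2.1 t.2.2.1 t.2.2.2)
    (fun t γ => stringSuffix K (α γ) (β γ) s t.1 t.2.1 t.2.2.1 t.2.2.2)
    (fun l γ => labelPrefix (α γ) (β γ) s l) (fun l γ => labelSuffix (α γ) (β γ) s l) ?_
    (fun t ht => inRange_cutLabel hd t (supp t ht).1 (supp t ht).2.1 (supp t ht).2.2)
    (fun t ht hl => funext fun γ =>
      stringPrefix_eq_labelPrefix _ _ hs t (supp t ht).1 (supp t ht).2.1 hl)
    (fun t ht hl => funext fun γ =>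
      stringSuffix_eq_labelSuffix _ _ t (supp t ht).1 (supp t ht).2.1 hl)
  intro γ η
  rw [twoParticle_apply_eq_sum_support]
  refine sum_congr rfl fun t _ => ?_
  rw [stringPrefix_mul_stringSuffix _ _ hs]
  congr 2
  · refine prod_congr rfl fun k hk => ?_
    have hk := mem_range.1 hk
    have hk' : k < K := by omega
    simp [α, β, extend, glue, hk, hk']
  · refine prod_congr rfl fun k hk => ?_
    obtain ⟨hk, hk'⟩ := Finset.mem_Ico.1 hk
    simp [α, β, extend, glue, hk.not_gt, hk']

theorem card_window_le (a b : ℕ) :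
    ((univ : Finset (Fin K)).filter fun i => a ≤ i.val ∧ i.val < b).card ≤ b - a := by
  have h : ((univ : Finset (Fin K)).filter fun i => a ≤ i.val ∧ i.val < b).image Fin.val ⊆
      Finset.Ico a b := by
    intro x
    simp only [mem_image, mem_filter, Finset.mem_Ico]
    rintro ⟨i, h, rfl⟩
    exact h.2
  simpa [card_image_of_injective _ Fin.val_injective] using card_le_card h

theorem card_inRange_le {s d P Q : ℕ} (hd : 1 ≤ d) :
    (Fintype.card {l : Label K // InRange s d P Q l} : ℤ) ≤
      4 * d - 2 + (2 * (P : ℤ) ^ 2 - P) + (2 * (Q : ℤ) ^ 2 - Q) := by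
  let W (a b : ℕ) : Finset (Fin K) := univ.filter fun i => a ≤ i.val ∧ i.val < b
  have hW : ∀ a b i, i ∈ W a b ↔ a ≤ i.val ∧ i.val < b := by simp [W]
  have h := card_labels_le (InRange (K := K) s d P Q) (W (s + 1 - d) s) (W (s - P) s) (W s (s + Q))
    (W s (s + d - 1))
    (by simp only [InRange, hW]; omega) (by simp only [InRange, hW]; omega)
    (by simp only [InRange, hW]; omega) (by simp only [InRange, hW]; omega)
    (by simp only [InRange, hW]; omega) (by simp only [InRange, hW]; omega)
    (by simp only [InRange, hW]; omega)
  have hC : ((W (s + 1 - d) s).card : ℤ) ≤ d - 1 := by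
    have := card_window_le (K := K) (s + 1 - d) s
    change (W _ _).card ≤ _ at this
    omega
  have hE : ((W s (s + d - 1)).card : ℤ) ≤ d - 1 := by
    have := card_window_le (K := K) s (s + d - 1)
    change (W _ _).card ≤ _ at this
    omega
  have hN : (W (s - P) s).card ≤ P := (card_window_le _ _).trans (by omega)
  have hN' : (W s (s + Q)).card ≤ Q := (card_window_le _ _).trans (by omega)
  -- Near the ends of the chain the windows are truncated, so their sizes are only bounded by `P`
  -- and `Q`; monotonicity of `2n² - n` on the naturals handles this.
  have mono : ∀ {n m : ℕ}, n ≤ m → 2 * (n : ℤ) ^ 2 - n ≤ 2 * (m : ℤ) ^ 2 - m := by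
    intro n m hnm
    obtain ⟨c, rfl⟩ := Nat.exists_eq_add_of_le hnm
    have hc : (c : ℤ) ≤ (c : ℤ) ^ 2 := by
      exact_mod_cast Nat.le_self_pow two_ne_zero c
    push_cast
    nlinarith [mul_nonneg (Int.natCast_nonneg n) (Int.natCast_nonneg c)]
  linarith [mono hN, mono hN']

/-- A two-particle operator of range `d` has a matrix product operator representation whose ranks do
not depend on the number of orbitals. -/
theorem exists_mpo_of_range (hK : 0 < K) {d : ℕ} (hd : 1 ≤ d)
    {v : Fin K → Fin K → Fin K → Fin K → ℝ}
    (hv : ∀ i₁ i₂ j₁ j₂ : Fin K, (d : ℤ) < spread i₁ i₂ j₁ j₂ → v i₁ i₂ j₁ j₂ = 0) :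
    ∃ M : MPO K, M.toMatrix = twoParticle v ∧ ∀ k : Fin (K + 1),
      (Odd d → (M.rank k : ℤ) ≤ (d : ℤ) ^ 2 + 3 * d - 1) ∧
      (Even d → (M.rank k : ℤ) ≤ (d : ℤ) ^ 2 + 3 * d - 2) := by
  -- The split is `P = ⌈d/2⌉`, `Q = ⌊d/2⌋`, which minimizes `P² + Q²` for `P + Q = d`.
  let r : ℕ := (4 * d - 2 + (2 * ((d - d / 2 : ℕ) : ℤ) ^ 2 - (d - d / 2 : ℕ)) +
    (2 * ((d / 2 : ℕ) : ℤ) ^ 2 - (d / 2 : ℕ))).toNat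
  have sq_le : ∀ n : ℕ, (n : ℤ) ≤ (n : ℤ) ^ 2 := fun n => by
    exact_mod_cast Nat.le_self_pow two_ne_zero n
  have hr : (r : ℤ) = 4 * d - 2 + (2 * ((d - d / 2 : ℕ) : ℤ) ^ 2 - (d - d / 2 : ℕ)) +
      (2 * ((d / 2 : ℕ) : ℤ) ^ 2 - (d / 2 : ℕ)) := by
    refine Int.toNat_of_nonneg ?_
    have := sq_le (d - d / 2)
    have := sq_le (d / 2)
    omega
  have hr1 : 1 ≤ r := by
    have := sq_le (d - d / 2)
    have := sq_le (d / 2)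
    omega
  obtain ⟨M, hM, hrank⟩ := exists_mpo_of_cutRankLE hK (twoParticle v) r hr1 fun s hs => by
    obtain ⟨ι, hι, L, R, hcard, h⟩ :=
      cutRankLE_twoParticle (P := d - d / 2) (Q := d / 2) hs (by omega) hv
    refine ⟨ι, hι, L, R, hcard.trans ?_, h⟩
    have := card_inRange_le (K := K) (s := s) (P := d - d / 2) (Q := d / 2) hd
    omega
  refine ⟨M, hM, fun k => ?_⟩
  have hk : (M.rank k : ℤ) ≤ r := by exact_mod_cast hrank k
  rw [hr] at hk
  refine ⟨?_, ?_⟩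
  · rintro ⟨m, rfl⟩
    have h1 : (2 * m + 1) / 2 = m := by omega
    have h2 : 2 * m + 1 - m = m + 1 := by omega
    rw [h1, h2] at hk
    push_cast at hk ⊢
    linarith
  · rintro ⟨m, rfl⟩
    have h1 : (m + m) / 2 = m := by omega
    have h2 : m + m - m = m := by omega
    rw [h1, h2] at hk
    push_cast at hk ⊢
    linarith

end FiniteRange

end FockMPO

theorem mainTheorem4 (K : ℕ) (hK : 2 ≤ K) (hEven : Even K)
    (v : Fin K → Fin K → Fin K → Fin K → ℝ) :
    (FockMPO.explicitMPO hK v).toMatrix = FockMPO.twoParticle v ∧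
    (∀ k : Fin (K + 1),
      ((FockMPO.explicitMPO hK v).rank k : ℝ) ≤ (K : ℝ) ^ 2 / 2 + 3 * (K : ℝ) / 2 + 2) ∧
    (∀ d : ℕ, 1 ≤ d →
      (∀ i₁ i₂ j₁ j₂ : Fin K, (d : ℤ) < FockMPO.spread i₁ i₂ j₁ j₂ → v i₁ i₂ j₁ j₂ = 0) →
      ∃ M : FockMPO.MPO K, M.toMatrix = FockMPO.twoParticle v ∧
        ∀ k : Fin (K + 1),
          (Odd d → (M.rank k : ℤ) ≤ (d : ℤ) ^ 2 + 3 * d - 1) ∧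
          (Even d → (M.rank k : ℤ) ≤ (d : ℤ) ^ 2 + 3 * d - 2)) :=
  ⟨FockMPO.explicitMPO_toMatrix hK v, FockMPO.explicitMPO_rank_le hK hEven v,
    fun _ hd hv => FockMPO.exists_mpo_of_range (by omega) hd hv⟩
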